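/- All rings are unital and, for an abelian group $V$, $V^n$ denotes the row vectors of length $n$ over $V$. **Rank functions.** A *Sylvester matrix rank function* of a ring $R$ is a function $\mathrm{rk}$ from the rectangular matrices over $R$ to $[0,\infty)$ with $\mathrm{rk}(0)=0$, $\mathrm{rk}(1_R)=1$, $\mathrm{rk}(AB)\le\min(\mathrm{rk}(A),\mathrm{rk}(B))$, $\mathrm{rk}\begin{pmatrix}A&0\\0&B\end{pmatrix}=\mathrm{rk}(A)+\mathrm{rk}(B)$ and $\mathrm{rk}\begin{pmatrix}A&C\\0&B\end{pmatrix}\ge\mathrm{rk}(A)+\mathrm{rk}(B)$. If $R$ has such a function, then a finitely generated free left $R$-module $\mathcal M\cong R^k$ determines $k$, and we write $\dim(\mathcal M)=k$. A *bivariant Sylvester module rank function* of $R$ assigns to each pair of left $R$-modules $\mathcal M_1\subseteq\mathcal M_2$ a value $\dim(\mathcal M_1|\mathcal M_2)\in[0,\infty]$ such that, with $\dim(\mathcal M):=\dim(\mathcal M|\mathcal M)$ (for this function): it is an isomorphism invariant; $\dim(\{0\})=0$ and $\dim(R)=1$; it is additive under direct sums of pairs; $\dim(\mathcal M_1|\mathcal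 M_2)$ is the supremum of $\dim(\mathcal M_1'|\mathcal M_2)$ over the finitely generated submodules $\mathcal M_1'$ of $\mathcal M_1$; if $\mathcal M_1$ is finitely generated, $\dim(\mathcal M_1|\mathcal M_2)$ is the infimum of $\dim(\mathcal M_1|\mathcal M_2')$ over the finitely generated $\mathcal M_2'$ with $\mathcal M_1\subseteq\mathcal M_2'\subseteq\mathcal M_2$; and $\dim(\mathcal M_2)=\dim(\mathcal M_1|\mathcal M_2)+\dim(\mathcal M_2/\mathcal M_1)$. For each $\mathrm{rk}$ there is exactly one such function with $\dim(R^nA|R^m)=\mathrm{rk}(A)$ for all $A\in M_{n,m}(R)$; it is said to correspond to $\mathrm{rk}$. **Extensions.** Let $S$ be a ring, $R\subseteq S$ a subring with $1_R=1_S$, and $\mathrm{rk}$ a Sylvester matrix rank function of $R$ with corresponding $\dim(\cdot|\cdot)$. For subsets $X\subseteq S$ and $Y$ of a left $S$-module, $XY$ is the set of finite sums of products $xy$ with $x\in X$, $y\in Y$. Let $\mathcal F$ be a collection of left $R$-submodules of $S$, and $\hat{\mathcal F}$ the set of its nonzero members. Suppose that 1. ($\mathcal F$ is a *finite approximation system*)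 every $\mathcal W\in\mathcal F$ is finitely generated and free; $\mathcal W\cap\mathcal V,\ \mathcal W+\mathcal V\in\mathcal F$ for $\mathcal W,\mathcal V\in\mathcal F$; if $\mathcal V\subseteq\mathcal W$ are in $\mathcal F$, then $\mathcal W=\mathcal V\oplus\mathcal V'$ for some $\mathcal V'\in\mathcal F$; every finitely generated left $R$-submodule of $S$ lies in some $\mathcal W\in\mathcal F$; 2. (*right amenability*) for every finite $V\subseteq S$ and $\varepsilon>0$ some $\mathcal W\in\hat{\mathcal F}$ is *$(V,\varepsilon)$-invariant*, i.e. $\dim(\tilde{\mathcal W})\le(1+\varepsilon)\dim(\mathcal W)$ for some $\tilde{\mathcal W}\in\mathcal F$ containing $\mathcal W+\mathcal WV$; 3. (*normality*) there is a set $\mathcal U\subseteq S$, containing $1_S$ and closed under multiplication, of nonzero elements $g$ that are not left or right zero-divisors and satisfy $gR=Rg$, such that every $\mathcal W\in\mathcal F$ has an $R$-basis in $\mathcal U$; $Rg\in\mathcal F$ for $g\in\mathcal U$; and $\{x\in S: xg\in\mathcal W\}\in\mathcal F$ whenever $g\in\mathcal U$, $\mathcal W\in\mathcal F$ and $\mathcal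 W\subseteq Sg$; 4. (*$\mathrm{rk}$ is preserved*) for every $g\in\mathcal U$, $\mathrm{rk}$ is invariant under the automorphism $\sigma_g$ of $R$ given by $ga=\sigma_g(a)g$. For $A\in M_{n,m}(S)$ and $\mathcal W\in\hat{\mathcal F}$, choose $\tilde{\mathcal W}\in\hat{\mathcal F}$ with $\mathcal WA_{ij}\subseteq\tilde{\mathcal W}$ for all $i,j$, an $R$-basis $w_1,\dots,w_l$ of $\mathcal W^n$ and an $R$-basis $\tilde w_1,\dots,\tilde w_p$ of $\tilde{\mathcal W}^m$; let $B\in M_{l,p}(R)$ be the matrix with $w_kA=\sum_qB_{kq}\tilde w_q$ for all $k$, and put $\mathrm{rk}_{\mathcal W}(A)=\mathrm{rk}(B)$, which does not depend on the choices. A function $\psi$ on $\hat{\mathcal F}$ with values in $[-\infty,\infty]$ *converges to $L\in[-\infty,\infty]$ when $\mathcal W$ becomes more and more right invariant*, written $\lim_{\mathcal W}\psi(\mathcal W)=L$, if for each neighborhood $O$ of $L$ there are $\mathcal V\in\mathcal F$ and $\delta>0$ such that $\psi(\mathcal W)\in O$ for all $\mathcal W\in\hat{\mathcal F}$ with $\dim(\mathcal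 W+\mathcal W\mathcal V)\le(1+\delta)\dim(\mathcal W)$. For left $S$-modules $\mathcal N_1\subseteq\mathcal N_2$ with $\mathcal N_1$ finitely generated, $\dim_{\mathcal F}(\mathcal N_1|\mathcal N_2)=L$ means that $\lim_{\mathcal W}\dim(\mathcal W\mathcal M_1|\mathcal N_2)/\dim(\mathcal W)=L$ for every finitely generated $R$-submodule $\mathcal M_1$ of $\mathcal N_1$ that generates $\mathcal N_1$ as an $S$-module. An ultrafilter $\omega$ on $\hat{\mathcal F}$ is *non-principal* if it contains the set of all $(V,\varepsilon)$-invariant $\mathcal W\in\hat{\mathcal F}$ for every finite $V\subseteq S$ and every $\varepsilon>0$. **Theorem.** For every $A\in M_{n,m}(S)$, $$\lim_{\mathcal W}\frac{\mathrm{rk}_{\mathcal W}(A)}{\dim(\mathcal W)}=\inf_{\mathcal V\in\hat{\mathcal F}}\frac{\mathrm{rk}_{\mathcal V}(A)}{\dim(\mathcal V)}=\dim_{\mathcal F}(S^nA\,|\,S^m),$$ and for every non-principal ultrafilter $\omega$ on $\hat{\mathcal F}$ the ultralimit $\mathrm{rk}_{\mathcal F}(A)=\lim_{\mathcal W\to\omega}\mathrm{rk}_{\mathcal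 W}(A)/\dim(\mathcal W)$ exists and equals this number. In particular $\mathrm{rk}_{\mathcal F}$ does not depend on the choice of $\omega$. -/

import Mathlib

open scoped ENNReal Topology

universe u

/-! ### Sylvester matrix rank functions -/

/-- A Sylvester matrix rank function for a unital ring `R` (Malcolmson). -/
structure SylvesterMatrixRank (R : Type u) [Ring R] where
  /-- the rank of a rectangular matrix -/
  rk : ∀ {n m : ℕ}, Matrix (Fin n) (Fin m) R → ℝ
  nonneg : ∀ {n m : ℕ} (A : Matrix (Fin n) (Fin m) R), 0 ≤ rk A
  zero : ∀ n m : ℕ, rk (0 : Matrix (Fin n) (Fin m) R) = 0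
  one : rk (1 : Matrix (Fin 1) (Fin 1) R) = 1
  mul_le_left : ∀ {n m l : ℕ} (A : Matrix (Fin n) (Fin m) R) (B : Matrix (Fin m) (Fin l) R),
    rk (A * B) ≤ rk A
  mul_le_right : ∀ {n m l : ℕ} (A : Matrix (Fin n) (Fin m) R) (B : Matrix (Fin m) (Fin l) R),
    rk (A * B) ≤ rk B
  diag : ∀ {n m k l : ℕ} (A : Matrix (Fin n) (Fin m) R) (B : Matrix (Fin k) (Fin l) R),
    rk (Matrix.reindex finSumFinEquiv finSumFinEquiv (Matrix.fromBlocks A 0 0 B)) = rk A + rk B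
  upper : ∀ {n m k l : ℕ} (A : Matrix (Fin n) (Fin m) R) (B : Matrix (Fin k) (Fin l) R)
    (C : Matrix (Fin n) (Fin l) R),
    rk A + rk B ≤ rk (Matrix.reindex finSumFinEquiv finSumFinEquiv (Matrix.fromBlocks A C 0 B))

namespace SylvesterMatrixRank

variable {R : Type u} [Ring R] (rk : SylvesterMatrixRank R)

/-- The rank of a matrix whose rows and columns are indexed by arbitrary finite types. -/
noncomputable def rkF {ι κ : Type*} [Fintype ι] [Fintype κ] (A : Matrix ι κ R) : ℝ :=
  rk.rk (Matrix.reindex (Fintype.equivFin ι) (Fintype.equivFin κ) A)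

section rkF

variable {ι κ μ ν : Type*} [Fintype ι] [Fintype κ] [Fintype μ] [Fintype ν]

theorem rkF_nonneg (A : Matrix ι κ R) : 0 ≤ rk.rkF A := rk.nonneg _

theorem rkF_zero : rk.rkF (0 : Matrix ι κ R) = 0 := rk.zero _ _

theorem rk_submatrix_le {n m n' m' : ℕ} (A : Matrix (Fin n) (Fin m) R)
    (f : Fin n' → Fin n) (g : Fin m' → Fin m) : rk.rk (A.submatrix f g) ≤ rk.rk A := by
  have h : A.submatrix f g = ((1 : Matrix (Fin n) (Fin n) R).submatrix f id * A) *
      (1 : Matrix (Fin m) (Fin m) R).submatrix id g := by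
    ext i j
    simp [Matrix.mul_apply, Matrix.one_apply]
  rw [h]
  exact (rk.mul_le_left _ _).trans (rk.mul_le_right _ _)

theorem rkF_eq {n m : ℕ} (A : Matrix ι κ R) (e : ι ≃ Fin n) (f : κ ≃ Fin m) :
    rk.rkF A = rk.rk (Matrix.reindex e f A) := by
  apply le_antisymm
  · have := rk.rk_submatrix_le (Matrix.reindex e f A) (e ∘ (Fintype.equivFin ι).symm)
      (f ∘ (Fintype.equivFin κ).symm)
    refine le_trans (le_of_eq ?_) this
    unfold rkF
    congr 1
    ext i j
    simp
  · have := rk.rk_submatrix_le (Matrix.reindex (Fintype.equivFin ι) (Fintype.equivFin κ) A)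
      ((Fintype.equivFin ι) ∘ e.symm) ((Fintype.equivFin κ) ∘ f.symm)
    refine le_trans (le_of_eq ?_) this
    congr 1
    ext i j
    simp

theorem rkF_fin {n m : ℕ} (A : Matrix (Fin n) (Fin m) R) : rk.rkF A = rk.rk A := by
  rw [rk.rkF_eq A (Equiv.refl _) (Equiv.refl _)]
  simp

theorem rkF_mul_le_left (A : Matrix ι κ R) (B : Matrix κ μ R) : rk.rkF (A * B) ≤ rk.rkF A := by
  unfold rkF
  rw [Matrix.reindex_apply, ← Matrix.submatrix_mul_equiv A B _ (Fintype.equivFin κ).symm _]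
  exact rk.mul_le_left _ _

theorem rkF_mul_le_right (A : Matrix ι κ R) (B : Matrix κ μ R) : rk.rkF (A * B) ≤ rk.rkF B := by
  unfold rkF
  rw [Matrix.reindex_apply, ← Matrix.submatrix_mul_equiv A B _ (Fintype.equivFin κ).symm _]
  exact rk.mul_le_right _ _

theorem rkF_submatrix_le (A : Matrix ι κ R) (f : μ → ι) (g : ν → κ) :
    rk.rkF (A.submatrix f g) ≤ rk.rkF A := by
  classical
  have h : A.submatrix f g = ((1 : Matrix ι ι R).submatrix f id * A) *
      (1 : Matrix κ κ R).submatrix id g := by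
    ext i j
    simp [Matrix.mul_apply, Matrix.one_apply]
  rw [h]
  exact (rk.rkF_mul_le_left _ _).trans (rk.rkF_mul_le_right _ _)

theorem rkF_submatrix_equiv (A : Matrix ι κ R) (f : μ ≃ ι) (g : ν ≃ κ) :
    rk.rkF (A.submatrix f g) = rk.rkF A := by
  apply le_antisymm (rk.rkF_submatrix_le _ _ _)
  have := rk.rkF_submatrix_le (A.submatrix f g) f.symm g.symm
  simpa using this

theorem rkF_diag (A : Matrix ι κ R) (B : Matrix μ ν R) :
    rk.rkF (Matrix.fromBlocks A 0 0 B) = rk.rkF A + rk.rkF B := by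
  rw [rk.rkF_eq _ (((Fintype.equivFin ι).sumCongr (Fintype.equivFin μ)).trans finSumFinEquiv)
    (((Fintype.equivFin κ).sumCongr (Fintype.equivFin ν)).trans finSumFinEquiv)]
  unfold rkF
  rw [← rk.diag]
  congr 1
  ext i j
  obtain ⟨i, rfl⟩ := finSumFinEquiv.surjective i
  obtain ⟨j, rfl⟩ := finSumFinEquiv.surjective j
  rcases i with i | i <;> rcases j with j | j <;> simp

theorem rkF_upper (A : Matrix ι κ R) (B : Matrix μ ν R) (C : Matrix ι ν R) :
    rk.rkF A + rk.rkF B ≤ rk.rkF (Matrix.fromBlocks A C 0 B) := by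
  rw [rk.rkF_eq (Matrix.fromBlocks A C 0 B)
    (((Fintype.equivFin ι).sumCongr (Fintype.equivFin μ)).trans finSumFinEquiv)
    (((Fintype.equivFin κ).sumCongr (Fintype.equivFin ν)).trans finSumFinEquiv)]
  unfold rkF
  refine (rk.upper _ _ (Matrix.reindex (Fintype.equivFin ι) (Fintype.equivFin ν) C)).trans
    (le_of_eq ?_)
  congr 1
  ext i j
  obtain ⟨i, rfl⟩ := finSumFinEquiv.surjective i
  obtain ⟨j, rfl⟩ := finSumFinEquiv.surjective j
  rcases i with i | i <;> rcases j with j | j <;> simp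

theorem rkF_one_unique [Unique ι] [DecidableEq ι] : rk.rkF (1 : Matrix ι ι R) = 1 := by
  rw [rk.rkF_eq _ (Equiv.ofUnique ι (Fin 1)) (Equiv.ofUnique ι (Fin 1)), ← rk.one]
  congr 1
  simp

theorem rkF_le_left (A : Matrix ι κ R) (B : Matrix μ κ R) :
    rk.rkF A ≤ rk.rkF (Matrix.fromRows A B) := by
  have := rk.rkF_submatrix_le (Matrix.fromRows A B) Sum.inl id
  exact this

theorem rkF_le_right (A : Matrix ι κ R) (B : Matrix μ κ R) :
    rk.rkF B ≤ rk.rkF (Matrix.fromRows A B) := by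
  have := rk.rkF_submatrix_le (Matrix.fromRows A B) Sum.inr id
  exact this

theorem rkF_fromCols_le (A : Matrix ι κ R) (B : Matrix ι ν R) :
    rk.rkF (Matrix.fromCols A B) ≤ rk.rkF A + rk.rkF B := by
  classical
  rw [← rk.rkF_diag]
  have h : Matrix.fromCols A B =
      Matrix.fromCols (1 : Matrix ι ι R) (1 : Matrix ι ι R) * Matrix.fromBlocks A 0 0 B := by
    rw [Matrix.fromCols_mul_fromBlocks]
    simp
  rw [h]
  exact rk.rkF_mul_le_right _ _

theorem rkF_fromRows_le (A : Matrix ι κ R) (B : Matrix μ κ R) :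
    rk.rkF (Matrix.fromRows A B) ≤ rk.rkF A + rk.rkF B := by
  classical
  rw [← rk.rkF_diag]
  have h : Matrix.fromRows A B =
      Matrix.fromBlocks A 0 0 B * Matrix.fromRows (1 : Matrix κ κ R) (1 : Matrix κ κ R) := by
    rw [Matrix.fromBlocks_mul_fromRows]
    simp
  rw [h]
  exact rk.rkF_mul_le_left _ _

end rkF
end SylvesterMatrixRank

/-! ### The bivariant Sylvester module rank function of a Sylvester matrix rank function -/

/-- The product of a matrix over `R` and a column vector with entries in a left `R`-module. -/
def matTuple {R : Type*} [Ring R] {M : Type*} [AddCommGroup M] [Module R M] {ι κ : Type*}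
    [Fintype κ] (C : Matrix ι κ R) (y : κ → M) : ι → M :=
  fun i => ∑ j, C i j • y j

section matTuple

variable {R : Type*} [Ring R] {M M' : Type*} [AddCommGroup M] [Module R M]
  [AddCommGroup M'] [Module R M'] {ι κ μ ν : Type*} [Fintype κ] [Fintype μ] [Fintype ν]

theorem matTuple_apply (C : Matrix ι κ R) (y : κ → M) (i : ι) :
    matTuple C y i = ∑ j, C i j • y j := rfl

theorem matTuple_mul (A : Matrix ι μ R) (C : Matrix μ κ R) (y : κ → M) :
    matTuple (A * C) y = matTuple A (matTuple C y) := by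
  ext i
  simp only [matTuple_apply, Matrix.mul_apply, Finset.sum_smul, Finset.smul_sum, mul_smul]
  exact Finset.sum_comm

theorem matTuple_one [DecidableEq κ] (y : κ → M) : matTuple (1 : Matrix κ κ R) y = y := by
  ext i
  simp [matTuple_apply, Matrix.one_apply]

theorem matTuple_zero_right (C : Matrix ι κ R) : matTuple C (0 : κ → M) = 0 := by
  ext i
  simp [matTuple_apply]

theorem matTuple_fromRows {ν : Type*} (A : Matrix ι κ R) (B : Matrix ν κ R) (y : κ → M) :
    matTuple (Matrix.fromRows A B) y = Sum.elim (matTuple A y) (matTuple B y) := by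
  ext i
  rcases i with i | i <;> rfl

theorem matTuple_fromCols (A : Matrix ι κ R) (B : Matrix ι μ R) (y : κ → M) (z : μ → M) :
    matTuple (Matrix.fromCols A B) (Sum.elim y z) = matTuple A y + matTuple B z := by
  ext i
  simp [matTuple_apply]

theorem matTuple_zero_left (y : κ → M) : matTuple (0 : Matrix ι κ R) y = 0 := by
  ext i
  simp [matTuple_apply]

theorem matTuple_map (f : M →ₗ[R] M') (C : Matrix ι κ R) (y : κ → M) :
    matTuple C (f ∘ y) = f ∘ matTuple C y := by
  ext i
  simp [matTuple_apply]

theorem matTuple_mem (N : Submodule R M) (C : Matrix ι κ R) (y : κ → M) (h : ∀ j, y j ∈ N)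
    (i : ι) : matTuple C y i ∈ N :=
  N.sum_mem fun j _ => N.smul_mem _ (h j)

theorem exists_matTuple_of_mem_span (y : κ → M) (x : ι → M)
    (h : ∀ i, x i ∈ Submodule.span R (Set.range y)) : ∃ C : Matrix ι κ R, matTuple C y = x := by
  have h' : ∀ i, ∃ c : κ → R, ∑ j, c j • y j = x i := fun i =>
    (Submodule.mem_span_range_iff_exists_fun R).1 (h i)
  choose C hC using h'
  exact ⟨Matrix.of C, funext hC⟩

theorem matTuple_rows {ν : Type*} (C : Matrix ι μ R) (Y : μ → ν → R) :
    matTuple C Y = fun i => (C * Matrix.of Y) i := by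
  ext i j
  simp [matTuple_apply, Matrix.mul_apply, Finset.sum_apply]

end matTuple

namespace SylvesterMatrixRank

variable {R : Type u} [Ring R] (rk : SylvesterMatrixRank R)

/-- The rank in `M` of the submodule generated by a finite tuple `x` of elements of `M`:
the infimum of `rk [C; B] - rk B` over all tuples `y` in `M` and matrices `C`, `B`
over `R` with `x = C y` and `B y = 0`. -/
noncomputable def tupleDim {M : Type*} [AddCommGroup M] [Module R M] {ι : Type*} [Fintype ι]
    (x : ι → M) : ℝ≥0∞ :=
  ⨅ (m : ℕ) (k : ℕ) (y : Fin m → M) (C : Matrix ι (Fin m) R) (B : Matrix (Fin k) (Fin m) R)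
    (_ : matTuple C y = x) (_ : matTuple B y = 0),
    ENNReal.ofReal (rk.rkF (Matrix.fromRows C B) - rk.rkF B)

/-- `rk.relDim N` is `dim(N|M)` for left `R`-modules `N ⊆ M`, where `dim(·|·)` is the bivariant
Sylvester module rank function corresponding to `rk`. That this formula does define a bivariant
Sylvester module rank function is `bivariant`, that it corresponds to `rk` is
`bivariant_corresponds`, and that no other one does is `dim_eq_of_corresponds`. -/
noncomputable def relDim {M : Type*} [AddCommGroup M] [Module R M] (N : Submodule R M) : ℝ≥0∞ :=
  ⨆ (n : ℕ) (x : Fin n → M) (_ : ∀ i, x i ∈ N), rk.tupleDim x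

section tupleDim

variable {M M' : Type*} [AddCommGroup M] [Module R M] [AddCommGroup M'] [Module R M']
  {ι ι' κ μ ν : Type*} [Fintype ι] [Fintype ι'] [Fintype κ] [Fintype μ] [Fintype ν]

theorem tupleDim_le {x : ι → M} (y : κ → M) (C : Matrix ι κ R) (B : Matrix μ κ R)
    (hC : matTuple C y = x) (hB : matTuple B y = 0) :
    rk.tupleDim x ≤ ENNReal.ofReal (rk.rkF (Matrix.fromRows C B) - rk.rkF B) := by
  let e := (Fintype.equivFin κ).symm
  let f := (Fintype.equivFin μ).symm
  refine iInf_le_of_le _ <| iInf_le_of_le _ <| iInf_le_of_le (y ∘ e) <|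
    iInf_le_of_le (C.submatrix id e) <| iInf_le_of_le (B.submatrix f e) <|
    iInf_le_of_le ?_ <| iInf_le_of_le ?_ ?_
  · ext i
    rw [← hC]
    exact Equiv.sum_comp e (fun j => C i j • y j)
  · ext i
    refine (Equiv.sum_comp e (fun j => B (f i) j • y j)).trans ?_
    exact congrFun hB (f i)
  · rw [rk.rkF_submatrix_equiv]
    have : Matrix.fromRows (C.submatrix id e) (B.submatrix f e) =
        (Matrix.fromRows C B).submatrix ((Equiv.refl ι).sumCongr f) e := by
      ext i j
      rcases i with i | i <;> rfl
    rw [this, rk.rkF_submatrix_equiv]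

theorem le_tupleDim {x : ι → M} {a : ℝ≥0∞}
    (h : ∀ (m k : ℕ) (y : Fin m → M) (C : Matrix ι (Fin m) R) (B : Matrix (Fin k) (Fin m) R),
      matTuple C y = x → matTuple B y = 0 →
      a ≤ ENNReal.ofReal (rk.rkF (Matrix.fromRows C B) - rk.rkF B)) : a ≤ rk.tupleDim x :=
  le_iInf fun m => le_iInf fun k => le_iInf fun y => le_iInf fun C => le_iInf fun B =>
    le_iInf fun hC => le_iInf fun hB => h m k y C B hC hB

theorem tupleDim_matTuple_le (E : Matrix ι' ι R) (x : ι → M) :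
    rk.tupleDim (matTuple E x) ≤ rk.tupleDim x := by
  classical
  refine rk.le_tupleDim fun m k y C B hC hB => ?_
  refine (rk.tupleDim_le y (E * C) B (by rw [matTuple_mul, hC]) hB).trans ?_
  refine ENNReal.ofReal_le_ofReal (sub_le_sub_right ?_ _)
  have : Matrix.fromRows (E * C) B =
      Matrix.fromBlocks E 0 0 (1 : Matrix (Fin k) (Fin k) R) * Matrix.fromRows C B := by
    rw [Matrix.fromBlocks_mul_fromRows]
    simp
  rw [this]
  exact rk.rkF_mul_le_right _ _

theorem tupleDim_mono_span {x : ι → M} {x' : ι' → M}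
    (h : ∀ i, x' i ∈ Submodule.span R (Set.range x)) : rk.tupleDim x' ≤ rk.tupleDim x := by
  obtain ⟨E, rfl⟩ := exists_matTuple_of_mem_span x x' h
  exact rk.tupleDim_matTuple_le E x

theorem tupleDim_map_le (f : M →ₗ[R] M') (x : ι → M) :
    rk.tupleDim (f ∘ x) ≤ rk.tupleDim x := by
  refine rk.le_tupleDim fun m k y C B hC hB => ?_
  refine rk.tupleDim_le (f ∘ y) C B ?_ ?_
  · rw [matTuple_map, hC]
  · rw [matTuple_map, hB]
    ext
    simp

theorem tupleDim_le_relDim {N : Submodule R M} (x : ι → M) (h : ∀ i, x i ∈ N) :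
    rk.tupleDim x ≤ rk.relDim N := by
  let e := (Fintype.equivFin ι).symm
  have h1 : rk.tupleDim x ≤ rk.tupleDim (x ∘ e) := rk.tupleDim_mono_span fun i =>
    Submodule.subset_span ⟨e.symm i, by simp⟩
  exact h1.trans (le_iSup_of_le _ <| le_iSup_of_le (x ∘ e) <|
    le_iSup_of_le (fun i => h _) le_rfl)

theorem relDim_le {N : Submodule R M} {a : ℝ≥0∞}
    (h : ∀ (n : ℕ) (x : Fin n → M), (∀ i, x i ∈ N) → rk.tupleDim x ≤ a) : rk.relDim N ≤ a :=
  iSup_le fun n => iSup_le fun x => iSup_le fun hx => h n x hx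

theorem relDim_add_le {N : Submodule R M} {N' : Submodule R M'} {a : ℝ≥0∞}
    (h : ∀ (n n' : ℕ) (x : Fin n → M) (x' : Fin n' → M'), (∀ i, x i ∈ N) → (∀ i, x' i ∈ N') →
      rk.tupleDim x + rk.tupleDim x' ≤ a) : rk.relDim N + rk.relDim N' ≤ a := by
  have e : ∀ {L : Type _} [AddCommGroup L] [Module R L] (N : Submodule R L), rk.relDim N =
      ⨆ p : Σ n : ℕ, {x : Fin n → L // ∀ i, x i ∈ N}, rk.tupleDim p.2.1 := by
    intro L _ _ N
    rw [iSup_sigma]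
    exact iSup_congr fun n => by rw [iSup_subtype]
  have e' : rk.relDim N' =
      ⨆ p : Σ n : ℕ, {x : Fin n → M' // ∀ i, x i ∈ N'}, rk.tupleDim p.2.1 := by
    rw [iSup_sigma]
    exact iSup_congr fun n => by rw [iSup_subtype]
  rw [e, e']
  have : Nonempty (Σ n : ℕ, {x : Fin n → M // ∀ i, x i ∈ N}) :=
    ⟨⟨0, 0, fun i => i.elim0⟩⟩
  have : Nonempty (Σ n : ℕ, {x : Fin n → M' // ∀ i, x i ∈ N'}) :=
    ⟨⟨0, 0, fun i => i.elim0⟩⟩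
  exact ENNReal.iSup_add_iSup_le fun p q => h _ _ _ _ p.2.2 q.2.2

theorem le_add_tupleDim {x : ι → M} {a b : ℝ≥0∞}
    (h : ∀ (m k : ℕ) (y : Fin m → M) (C : Matrix ι (Fin m) R) (B : Matrix (Fin k) (Fin m) R),
      matTuple C y = x → matTuple B y = 0 →
      a ≤ b + ENNReal.ofReal (rk.rkF (Matrix.fromRows C B) - rk.rkF B)) :
    a ≤ b + rk.tupleDim x := by
  unfold tupleDim
  simp only [ENNReal.add_iInf]
  exact le_iInf fun m => le_iInf fun k => le_iInf fun y => le_iInf fun C => le_iInf fun B =>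
    le_iInf fun hC => le_iInf fun hB => h m k y C B hC hB

theorem relDim_mono {N N' : Submodule R M} (h : N ≤ N') : rk.relDim N ≤ rk.relDim N' :=
  rk.relDim_le fun _ x hx => rk.tupleDim_le_relDim x fun i => h (hx i)

theorem relDim_span (x : ι → M) :
    rk.relDim (Submodule.span R (Set.range x)) = rk.tupleDim x :=
  le_antisymm (rk.relDim_le fun _ _ hx => rk.tupleDim_mono_span hx)
    (rk.tupleDim_le_relDim x fun i => Submodule.subset_span ⟨i, rfl⟩)

theorem relDim_map_le (f : M →ₗ[R] M') (N : Submodule R M) :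
    rk.relDim (N.map f) ≤ rk.relDim N := by
  refine rk.relDim_le fun n x hx => ?_
  choose z hz hzx using fun i => Submodule.mem_map.1 (hx i)
  have : x = f ∘ z := funext fun i => (hzx i).symm
  rw [this]
  exact (rk.tupleDim_map_le f z).trans (rk.tupleDim_le_relDim z hz)

theorem relDim_equiv (e : M ≃ₗ[R] M') (N : Submodule R M) :
    rk.relDim (N.map (e : M →ₗ[R] M')) = rk.relDim N := by
  refine le_antisymm (rk.relDim_map_le _ _) ?_
  have := rk.relDim_map_le (e.symm : M' →ₗ[R] M) (N.map (e : M →ₗ[R] M'))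
  rwa [← Submodule.map_comp, LinearEquiv.comp_coe, LinearEquiv.self_trans_symm,
    LinearEquiv.refl_toLinearMap, Submodule.map_id] at this

theorem tupleDim_zero : rk.tupleDim (0 : ι → M) = 0 := by
  have := rk.tupleDim_le (x := (0 : ι → M)) (fun i : Fin 0 => 0) (0 : Matrix ι (Fin 0) R)
    (0 : Matrix (Fin 0) (Fin 0) R) (matTuple_zero_left _) (matTuple_zero_left _)
  have h0 : Matrix.fromRows (0 : Matrix ι (Fin 0) R) (0 : Matrix (Fin 0) (Fin 0) R) = 0 := by
    ext i j
    exact j.elim0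
  rw [h0, rk.rkF_zero, rk.rkF_zero] at this
  simpa using this

theorem ofReal_split {a b c : ℝ} (h1 : c ≤ b) (h2 : b ≤ a) :
    ENNReal.ofReal (a - b) + ENNReal.ofReal (b - c) = ENNReal.ofReal (a - c) := by
  rw [← ENNReal.ofReal_add (by linarith) (by linarith)]
  congr 1
  ring

/-- `[X; Y; B]`, associated in the two ways. -/
theorem rkF_assoc (X : Matrix ι κ R) (Y : Matrix ι' κ R) (B : Matrix μ κ R) :
    rk.rkF (Matrix.fromRows (Matrix.fromRows X Y) B) =
      rk.rkF (Matrix.fromRows X (Matrix.fromRows Y B)) := by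
  rw [← rk.rkF_submatrix_equiv (Matrix.fromRows X (Matrix.fromRows Y B))
    (Equiv.sumAssoc _ _ _) (Equiv.refl _)]
  congr 1
  ext i j
  rcases i with (i | i) | i <;> rfl

theorem tupleDim_free (A : Matrix ι κ R) : rk.tupleDim (fun i => A i) =
    ENNReal.ofReal (rk.rkF A) := by
  classical
  apply le_antisymm
  · refine (rk.tupleDim_le (fun j => (1 : Matrix κ κ R) j) A (0 : Matrix (Fin 0) κ R) ?_
      (matTuple_zero_left _)).trans ?_
    · rw [matTuple_rows]
      ext i j
      exact congrFun (congrFun (Matrix.mul_one A) i) j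
    · refine ENNReal.ofReal_le_ofReal ?_
      have := rk.rkF_fromRows_le A (0 : Matrix (Fin 0) κ R)
      rw [rk.rkF_zero] at this ⊢
      linarith
  · refine rk.le_tupleDim fun m k y C B hC hB => ENNReal.ofReal_le_ofReal ?_
    have h1 : C * Matrix.of y = A := by
      ext i j
      rw [← congrFun (congrFun (matTuple_rows C y) i) j]
      exact congrFun (congrFun hC i) j
    have h2 : B * Matrix.of y = 0 := by
      ext i j
      rw [← congrFun (congrFun (matTuple_rows B y) i) j]
      exact congrFun (congrFun hB i) j
    have h3 : Matrix.fromRows C B * Matrix.fromCols (Matrix.of y) (1 : Matrix (Fin m) (Fin m) R) =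
        Matrix.fromBlocks A C 0 B := by
      rw [Matrix.fromRows_mul_fromCols, h1, h2]
      simp
    have h4 := rk.rkF_mul_le_left (Matrix.fromRows C B)
      (Matrix.fromCols (Matrix.of y) (1 : Matrix (Fin m) (Fin m) R))
    rw [h3] at h4
    have := rk.rkF_upper A B C
    linarith

/-- The rank of the row space of a matrix over `R`. -/
theorem relDim_range {n m : ℕ} (A : Matrix (Fin n) (Fin m) R) :
    rk.relDim (LinearMap.range A.vecMulLinear) = ENNReal.ofReal (rk.rk A) := by
  rw [range_vecMulLinear]
  exact (rk.relDim_span (fun i => A i)).trans ((rk.tupleDim_free A).trans (by rw [rk.rkF_fin]))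

theorem relDim_prod (N : Submodule R M) (N' : Submodule R M') :
    rk.relDim (N.prod N') = rk.relDim N + rk.relDim N' := by
  apply le_antisymm
  · refine rk.relDim_le fun n x hx => ?_
    refine le_trans ?_ (add_le_add
      (rk.tupleDim_le_relDim (N := N) (fun i => (x i).1) fun i => (hx i).1)
      (rk.tupleDim_le_relDim (N := N') (fun i => (x i).2) fun i => (hx i).2))
    refine rk.le_add_tupleDim fun m' k' y' C' B' hC' hB' => ?_
    rw [add_comm]
    refine rk.le_add_tupleDim fun m k y C B hC hB => ?_
    rw [add_comm]
    have e1 : ∀ {α : Type} (D : Matrix α (Fin m) R),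
        matTuple D (fun j => ((y j, 0) : M × M')) = fun i => (matTuple D y i, 0) :=
      fun D => matTuple_map (LinearMap.inl R M M') D y
    have e2 : ∀ {α : Type} (D : Matrix α (Fin m') R),
        matTuple D (fun j => ((0, y' j) : M × M')) = fun i => (0, matTuple D y' i) :=
      fun D => matTuple_map (LinearMap.inr R M M') D y'
    refine (rk.tupleDim_le (Sum.elim (fun j => ((y j, 0) : M × M')) (fun j => (0, y' j)))
      (Matrix.fromCols C C') (Matrix.fromBlocks B 0 0 B') ?_ ?_).trans ?_
    · rw [matTuple_fromCols, e1, e2, hC, hC']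
      ext i <;> simp
    · rw [← Matrix.fromRows_fromCols_eq_fromBlocks, matTuple_fromRows, matTuple_fromCols,
        matTuple_fromCols, e1, e1, e2, e2, hB, hB', matTuple_zero_left, matTuple_zero_left]
      ext i <;> rcases i with i | i <;> simp
    · rw [← ENNReal.ofReal_add (sub_nonneg.2 (rk.rkF_le_right _ _))
        (sub_nonneg.2 (rk.rkF_le_right _ _))]
      refine ENNReal.ofReal_le_ofReal ?_
      rw [rk.rkF_diag]
      have : Matrix.fromRows (Matrix.fromCols C C') (Matrix.fromBlocks B 0 0 B') =
          Matrix.fromCols (Matrix.fromRows C (Matrix.fromRows B (0 : Matrix (Fin k') (Fin m) R)))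
            (Matrix.fromRows C' (Matrix.fromRows (0 : Matrix (Fin k) (Fin m') R) B')) := by
        ext i j
        rcases i with i | i | i <;> rcases j with j | j <;> rfl
      rw [this]
      have h1 := rk.rkF_fromCols_le
        (Matrix.fromRows C (Matrix.fromRows B (0 : Matrix (Fin k') (Fin m) R)))
        (Matrix.fromRows C' (Matrix.fromRows (0 : Matrix (Fin k) (Fin m') R) B'))
      have h2 := rk.rkF_fromRows_le (Matrix.fromRows C B) (0 : Matrix (Fin k') (Fin m) R)
      rw [rk.rkF_assoc, rk.rkF_zero] at h2
      have h3 := rk.rkF_fromRows_le (Matrix.fromRows C' B') (0 : Matrix (Fin k) (Fin m') R)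
      rw [rk.rkF_zero, ← rk.rkF_submatrix_equiv _ ((Equiv.sumAssoc _ _ _).trans
        (((Equiv.refl _).sumCongr (Equiv.sumComm _ _)).trans (Equiv.sumAssoc _ _ _).symm))
        (Equiv.refl _)] at h3
      have h4 : (Matrix.fromRows (Matrix.fromRows C' B') (0 : Matrix (Fin k) (Fin m') R)).submatrix
          ((Equiv.sumAssoc _ _ _).trans
          (((Equiv.refl _).sumCongr (Equiv.sumComm _ _)).trans (Equiv.sumAssoc _ _ _).symm))
          (Equiv.refl _) =
          Matrix.fromRows (Matrix.fromRows C' (0 : Matrix (Fin k) (Fin m') R)) B' := by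
        ext i j
        rcases i with (i | i) | i <;> rfl
      rw [h4, rk.rkF_assoc] at h3
      linarith
  · refine rk.relDim_add_le fun n n' x x' hx hx' => ?_
    refine le_trans ?_ (rk.tupleDim_le_relDim (N := N.prod N')
      (Sum.elim (fun i => (x i, 0)) (fun i => (0, x' i))) ?_)
    · refine rk.le_tupleDim fun m k y C B hC hB => ?_
      have hC1 : matTuple C (fun j => (y j).1) = Sum.elim x (fun _ => 0) := by
        refine (matTuple_map (LinearMap.fst R M M') C y).trans ?_
        rw [hC]
        ext i
        rcases i with i | i <;> rfl
      have hC2 : matTuple C (fun j => (y j).2) = Sum.elim (fun _ => 0) x' := by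
        refine (matTuple_map (LinearMap.snd R M M') C y).trans ?_
        rw [hC]
        ext i
        rcases i with i | i <;> rfl
      have hB1 : matTuple B (fun j => (y j).1) = 0 := by
        refine (matTuple_map (LinearMap.fst R M M') B y).trans ?_
        rw [hB]
        ext i
        rfl
      have hB2 : matTuple B (fun j => (y j).2) = 0 := by
        refine (matTuple_map (LinearMap.snd R M M') B y).trans ?_
        rw [hB]
        ext i
        rfl
      obtain ⟨P, Q, rfl⟩ : ∃ P Q, C = Matrix.fromRows P Q :=
        ⟨C.toRows₁, C.toRows₂, (Matrix.fromRows_toRows C).symm⟩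
      rw [matTuple_fromRows] at hC1 hC2
      have hP1 : matTuple P (fun j => (y j).1) = x :=
        funext fun i => congrFun hC1 (Sum.inl i)
      have hQ1 : matTuple Q (fun j => (y j).1) = 0 :=
        funext fun i => congrFun hC1 (Sum.inr i)
      have hQ2 : matTuple Q (fun j => (y j).2) = x' :=
        funext fun i => congrFun hC2 (Sum.inr i)
      rw [rk.rkF_assoc, ← ofReal_split (rk.rkF_le_right Q B) (rk.rkF_le_right P _)]
      refine add_le_add (rk.tupleDim_le _ P (Matrix.fromRows Q B) hP1 ?_)
        (rk.tupleDim_le _ Q B hQ2 hB2)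
      rw [matTuple_fromRows, hQ1, hB1]
      ext i
      rcases i with i | i <;> rfl
    · rintro (i | i)
      · exact ⟨hx i, N'.zero_mem⟩
      · exact ⟨N.zero_mem, hx' i⟩

theorem relDim_add_quotient (N : Submodule R M) :
    rk.relDim (⊤ : Submodule R M) = rk.relDim N + rk.relDim (⊤ : Submodule R (M ⧸ N)) := by
  apply le_antisymm
  · refine rk.relDim_le fun n z _ => ?_
    refine le_trans ?_ (add_le_add le_rfl
      (rk.tupleDim_le_relDim (N := ⊤) (N.mkQ ∘ z) fun i => trivial))
    refine rk.le_add_tupleDim fun m k ybar C B hC hB => ?_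
    choose y hy using fun j => N.mkQ_surjective (ybar j)
    have hyb : ybar = N.mkQ ∘ y := funext fun j => (hy j).symm
    subst hyb
    rw [matTuple_map] at hC hB
    have hp : ∀ i, z i - matTuple C y i ∈ N := fun i => by
      rw [← Submodule.Quotient.mk_eq_zero, Submodule.Quotient.mk_sub, sub_eq_zero]
      exact (congrFun hC i).symm
    have hq : ∀ i, matTuple B y i ∈ N := fun i => by
      rw [← Submodule.Quotient.mk_eq_zero]
      exact congrFun hB i
    refine le_trans ?_ (add_le_add (rk.tupleDim_le_relDim
      (Sum.elim (fun i => z i - matTuple C y i) (fun i => -matTuple B y i)) ?_) le_rfl)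
    swap
    · rintro (i | i)
      · exact hp i
      · exact N.neg_mem (hq i)
    rw [add_comm]
    refine rk.le_add_tupleDim fun m' k' y' D B' hD hB' => ?_
    obtain ⟨P, Q, rfl⟩ : ∃ P Q, D = Matrix.fromRows P Q :=
      ⟨D.toRows₁, D.toRows₂, (Matrix.fromRows_toRows D).symm⟩
    rw [matTuple_fromRows] at hD
    have hP : matTuple P y' = fun i => z i - matTuple C y i :=
      funext fun i => congrFun hD (Sum.inl i)
    have hQ : matTuple Q y' = fun i => -matTuple B y i := funext fun i => congrFun hD (Sum.inr i)
    refine (rk.tupleDim_le (Sum.elim y' y) (Matrix.fromCols P C)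
      (Matrix.fromBlocks B' 0 Q B) ?_ ?_).trans ?_
    · rw [matTuple_fromCols, hP]
      ext i
      simp
    · rw [← Matrix.fromRows_fromCols_eq_fromBlocks, matTuple_fromRows, matTuple_fromCols,
        matTuple_fromCols, hQ, hB', matTuple_zero_left]
      ext i
      rcases i with i | i <;> simp
    · rw [← ENNReal.ofReal_add (sub_nonneg.2 (rk.rkF_le_right _ _))
        (sub_nonneg.2 (rk.rkF_le_right _ _))]
      refine ENNReal.ofReal_le_ofReal ?_
      have h1 := rk.rkF_upper B B' Q
      have e1 : (Matrix.fromBlocks B' 0 Q B).submatrix (Equiv.sumComm _ _) (Equiv.sumComm _ _) =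
          Matrix.fromBlocks B Q 0 B' := by
        ext i j
        rcases i with i | i <;> rcases j with j | j <;> rfl
      rw [← e1, rk.rkF_submatrix_equiv] at h1
      have e2 : Matrix.fromRows (Matrix.fromCols P C) (Matrix.fromBlocks B' 0 Q B) =
          Matrix.fromCols
            ((Matrix.fromRows (Matrix.fromRows P Q) B').submatrix
              (Sum.elim (fun i => Sum.inl (Sum.inl i))
                (Sum.elim Sum.inr (fun i => Sum.inl (Sum.inr i)))) id)
            ((Matrix.fromRows (Matrix.fromRows C B) (0 : Matrix (Fin k') (Fin m) R)).submatrix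
              (Sum.elim (fun i => Sum.inl (Sum.inl i))
                (Sum.elim Sum.inr (fun i => Sum.inl (Sum.inr i)))) id) := by
        ext i j
        rcases i with i | i | i <;> rcases j with j | j <;> rfl
      rw [e2]
      refine (sub_le_sub_right (rk.rkF_fromCols_le _ _) _).trans ?_
      have h2 := rk.rkF_submatrix_le (Matrix.fromRows (Matrix.fromRows P Q) B')
        (Sum.elim (fun i => Sum.inl (Sum.inl i))
          (Sum.elim Sum.inr (fun i => Sum.inl (Sum.inr i)))) id
      have h3 := rk.rkF_submatrix_le
        (Matrix.fromRows (Matrix.fromRows C B) (0 : Matrix (Fin k') (Fin m) R))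
        (Sum.elim (fun i => Sum.inl (Sum.inl i))
          (Sum.elim Sum.inr (fun i => Sum.inl (Sum.inr i)))) id
      have h4 := rk.rkF_fromRows_le (Matrix.fromRows C B) (0 : Matrix (Fin k') (Fin m) R)
      rw [rk.rkF_zero] at h4
      linarith
  · refine rk.relDim_add_le fun n n' x zbar hx _ => ?_
    choose z hz using fun j => N.mkQ_surjective (zbar j)
    have hzb : zbar = N.mkQ ∘ z := funext fun j => (hz j).symm
    subst hzb
    refine le_trans ?_ (rk.tupleDim_le_relDim (N := ⊤) (Sum.elim z x) fun i => trivial)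
    refine rk.le_tupleDim fun m k y C B hC hB => ?_
    obtain ⟨P, Q, rfl⟩ : ∃ P Q, C = Matrix.fromRows P Q :=
      ⟨C.toRows₁, C.toRows₂, (Matrix.fromRows_toRows C).symm⟩
    rw [matTuple_fromRows] at hC
    have hP : matTuple P y = z := funext fun i => congrFun hC (Sum.inl i)
    have hQ : matTuple Q y = x := funext fun i => congrFun hC (Sum.inr i)
    rw [rk.rkF_assoc, ← ofReal_split (rk.rkF_le_right Q B) (rk.rkF_le_right P _), add_comm]
    refine add_le_add (rk.tupleDim_le (N.mkQ ∘ y) P (Matrix.fromRows Q B) ?_ ?_)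
      (rk.tupleDim_le y Q B hQ hB)
    · rw [matTuple_map, hP]
    · rw [matTuple_map, matTuple_fromRows, hQ, hB]
      ext i
      rcases i with i | i
      · exact (Submodule.Quotient.mk_eq_zero N).2 (hx i)
      · exact map_zero N.mkQ

end tupleDim
end SylvesterMatrixRank

/-- A bivariant Sylvester module rank function for a unital ring `R`: `dim N` stands for
`dim(N|M)`, where `N` is a submodule of a left `R`-module `M`. -/
structure BivariantModuleRank (R : Type u) [Ring R] where
  /-- the value `dim(N|M)` -/
  dim : ∀ {M : Type u} [AddCommGroup M] [Module R M], Submodule R M → ℝ≥0∞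
  dim_equiv : ∀ {M M' : Type u} [AddCommGroup M] [Module R M] [AddCommGroup M'] [Module R M']
    (e : M ≃ₗ[R] M') (N : Submodule R M), dim (N.map (e : M →ₗ[R] M')) = dim N
  dim_zero : dim (⊤ : Submodule R PUnit.{u + 1}) = 0
  dim_ring : dim (⊤ : Submodule R R) = 1
  dim_prod : ∀ {M M' : Type u} [AddCommGroup M] [Module R M] [AddCommGroup M'] [Module R M']
    (N : Submodule R M) (N' : Submodule R M'), dim (N.prod N') = dim N + dim N'
  dim_eq_iSup : ∀ {M : Type u} [AddCommGroup M] [Module R M] (N : Submodule R M),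
    dim N = ⨆ (N' : Submodule R M) (_ : N' ≤ N) (_ : N'.FG), dim N'
  dim_eq_iInf : ∀ {M : Type u} [AddCommGroup M] [Module R M] (N : Submodule R M), N.FG →
    dim N = ⨅ (P : Submodule R M) (_ : N ≤ P) (_ : P.FG), dim (N.submoduleOf P)
  dim_add_quotient : ∀ {M : Type u} [AddCommGroup M] [Module R M] (N : Submodule R M),
    dim (⊤ : Submodule R M) = dim N + dim (⊤ : Submodule R (M ⧸ N))

/-- `dim(·|·)` corresponds to `rk` if `rk(A) = dim(RⁿA|Rᵐ)` for all `n × m` matrices `A`. -/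
def BivariantModuleRank.Corresponds {R : Type u} [Ring R] (d : BivariantModuleRank R)
    (rk : SylvesterMatrixRank R) : Prop :=
  ∀ (n m : ℕ) (A : Matrix (Fin n) (Fin m) R),
    d.dim (LinearMap.range A.vecMulLinear) = ENNReal.ofReal (rk.rk A)

namespace SylvesterMatrixRank

variable {R : Type u} [Ring R] (rk : SylvesterMatrixRank R)

/-- `relDim` as a bivariant Sylvester module rank function. -/
noncomputable def bivariant : BivariantModuleRank R where
  dim N := rk.relDim N
  dim_equiv e N := rk.relDim_equiv e N
  dim_zero := by
    refine le_antisymm (rk.relDim_le fun n x _ => ?_) bot_le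
    rw [show x = 0 from Subsingleton.elim _ _, rk.tupleDim_zero]
  dim_ring := by
    have h := rk.relDim_range (1 : Matrix (Fin 1) (Fin 1) R)
    rw [rk.one, ENNReal.ofReal_one] at h
    rw [← h, ← rk.relDim_equiv (LinearEquiv.funUnique (Fin 1) R R)]
    congr 1
    symm
    rw [eq_top_iff]
    rintro x -
    exact ⟨fun _ => x, ⟨fun _ => x, by simp⟩, rfl⟩
  dim_prod N N' := rk.relDim_prod N N'
  dim_eq_iSup N := by
    refine le_antisymm (rk.relDim_le fun n x hx => ?_)
      (iSup_le fun N' => iSup_le fun h => iSup_le fun _ => rk.relDim_mono h)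
    rw [← rk.relDim_span]
    refine le_iSup_of_le _ <| le_iSup_of_le ?_ <| le_iSup_of_le ?_ le_rfl
    · rw [Submodule.span_le]
      rintro _ ⟨i, rfl⟩
      exact hx i
    · exact Submodule.fg_span (Set.finite_range x)
  dim_eq_iInf {M} _ _ N hN := by
    apply le_antisymm
    · refine le_iInf fun P => le_iInf fun h => le_iInf fun _ => ?_
      have := rk.relDim_map_le P.subtype (N.submoduleOf P)
      rwa [Submodule.submoduleOf, Submodule.map_comap_subtype, inf_eq_right.2 h] at this
    · obtain ⟨n, x, rfl⟩ := Submodule.fg_iff_exists_fin_generating_family.1 hN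
      rw [rk.relDim_span]
      refine rk.le_tupleDim fun m k y C B hC hB => ?_
      have hxy : Submodule.span R (Set.range x) ≤ Submodule.span R (Set.range y) := by
        rw [Submodule.span_le]
        rintro _ ⟨i, rfl⟩
        rw [← hC]
        exact matTuple_mem (Submodule.span R (Set.range y)) C y (fun j => Submodule.subset_span ⟨j, rfl⟩) i
      refine iInf_le_of_le _ <| iInf_le_of_le hxy <|
        iInf_le_of_le (Submodule.fg_span (Set.finite_range y)) ?_
      have hx : ∀ i, x i ∈ Submodule.span R (Set.range y) :=
        fun i => hxy (Submodule.subset_span ⟨i, rfl⟩)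
      have e : (Submodule.span R (Set.range x)).submoduleOf (Submodule.span R (Set.range y)) =
          Submodule.span R (Set.range fun i =>
            (⟨x i, hx i⟩ : Submodule.span R (Set.range y))) := by
        apply Submodule.map_injective_of_injective (Submodule.subtype_injective _)
        rw [Submodule.submoduleOf, Submodule.map_comap_subtype, inf_eq_right.2 hxy,
          Submodule.map_span, ← Set.range_comp]
        rfl
      rw [e, rk.relDim_span]
      let y' : Fin m → Submodule.span R (Set.range y) :=
        fun j => ⟨y j, Submodule.subset_span ⟨j, rfl⟩⟩
      refine rk.tupleDim_le y' C B ?_ ?_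
      · ext i
        exact (congrFun (matTuple_map (Submodule.subtype _) C y') i).symm.trans (congrFun hC i)
      · ext i
        exact (congrFun (matTuple_map (Submodule.subtype _) B y') i).symm.trans (congrFun hB i)
  dim_add_quotient N := rk.relDim_add_quotient N

theorem bivariant_corresponds : rk.bivariant.Corresponds rk := fun _ _ A => rk.relDim_range A

/-- There is only one bivariant Sylvester module rank function corresponding to `rk`. -/
theorem dim_eq_of_corresponds (d d' : BivariantModuleRank R) (h : d.Corresponds rk)
    (h' : d'.Corresponds rk) {M : Type u} [AddCommGroup M] [Module R M] (N : Submodule R M) :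
    d.dim N = d'.dim N := by
  have h1 : ∀ (m : ℕ) (K : Submodule R (Fin m → R)), d.dim K = d'.dim K := by
    intro m K
    rw [d.dim_eq_iSup, d'.dim_eq_iSup]
    refine iSup_congr fun K' => iSup_congr fun _ => iSup_congr fun hK' => ?_
    obtain ⟨n, x, rfl⟩ := Submodule.fg_iff_exists_fin_generating_family.1 hK'
    have e := range_vecMulLinear (Matrix.of x)
    have e' : Submodule.span R (Set.range x) = LinearMap.range (Matrix.of x).vecMulLinear :=
      e.symm
    rw [e', h, h']
  have h2 : ∀ (m : ℕ), d.dim (⊤ : Submodule R (Fin m → R)) ≠ ⊤ := by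
    intro m
    have e : LinearMap.range (1 : Matrix (Fin m) (Fin m) R).vecMulLinear = ⊤ := by
      rw [LinearMap.range_eq_top]
      intro x
      exact ⟨x, by simp⟩
    rw [← e, h]
    exact ENNReal.ofReal_ne_top
  have h3 : ∀ {P : Type u} [AddCommGroup P] [Module R P] [Module.Finite R P],
      d.dim (⊤ : Submodule R P) = d'.dim (⊤ : Submodule R P) ∧
        d.dim (⊤ : Submodule R P) ≠ ⊤ := by
    intro P _ _ _
    obtain ⟨m, f, hf⟩ := Module.Finite.exists_fin' R P
    have e := f.quotKerEquivOfSurjective hf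
    have e1 := d.dim_equiv e ⊤
    have e2 := d'.dim_equiv e ⊤
    rw [Submodule.map_top, LinearEquiv.range] at e1 e2
    have a1 := d.dim_add_quotient (LinearMap.ker f)
    have a2 := d'.dim_add_quotient (LinearMap.ker f)
    have hk := h2 m
    rw [e1, e2]
    rw [a1] at hk
    refine ⟨?_, fun ht => hk (by rw [ht, add_top])⟩
    rw [← h1 m ⊤, ← h1 m (LinearMap.ker f), a1] at a2
    exact (ENNReal.add_right_inj (fun ht => hk (by rw [ht, top_add]))).1 a2
  have h4 : ∀ {P : Type u} [AddCommGroup P] [Module R P] [Module.Finite R P]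
      (L : Submodule R P), d.dim L = d'.dim L := by
    intro P _ _ _ L
    have a1 := d.dim_add_quotient L
    have a2 := d'.dim_add_quotient L
    rw [← (h3 (P := P)).1, ← (h3 (P := P ⧸ L)).1, a1] at a2
    exact (ENNReal.add_left_inj (h3 (P := P ⧸ L)).2).1 a2
  rw [d.dim_eq_iSup, d'.dim_eq_iSup]
  refine iSup_congr fun N' => iSup_congr fun _ => iSup_congr fun hN' => ?_
  rw [d.dim_eq_iInf N' hN', d'.dim_eq_iInf N' hN']
  refine iInf_congr fun P => iInf_congr fun _ => iInf_congr fun hP => ?_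
  have : Module.Finite R P := Module.Finite.iff_fg.2 hP
  exact h4 _

end SylvesterMatrixRank

/-! ### Finite approximation systems and amenable normal extensions -/

/-- The rank `n` of a finitely generated free left `R`-module `M ≅ Rⁿ`, over a ring with invariant
basis number. (`Module.finrank` is defined by linearly independent families and differs
from this number over some rings with invariant basis number.) -/
noncomputable def freeDim (R : Type*) [Ring R] (M : Type*) [AddCommGroup M] [Module R M] : ℕ :=
  sInf {n : ℕ | Nonempty (M ≃ₗ[R] (Fin n → R))}

section extension

variable {S : Type u} [Ring S] {R : Subring S}

/-- A finite approximation system for the ring `S` over its subring `R`. -/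
structure IsFiniteApproxSystem (F : Set (Submodule R S)) : Prop where
  finite_free : ∀ W ∈ F, Module.Finite R W ∧ Module.Free R W
  inf_mem : ∀ W ∈ F, ∀ V ∈ F, W ⊓ V ∈ F
  sup_mem : ∀ W ∈ F, ∀ V ∈ F, W ⊔ V ∈ F
  exists_compl : ∀ W ∈ F, ∀ V ∈ F, V ≤ W → ∃ V' ∈ F, V ⊓ V' = ⊥ ∧ V ⊔ V' = W
  exists_ge : ∀ M : Submodule R S, M.FG → ∃ W ∈ F, M ≤ W

/-- The nonzero elements of `F`. -/
def hat (F : Set (Submodule R S)) : Set (Submodule R S) := {W | W ∈ F ∧ W ≠ ⊥}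

/-- `W` is `(V, ε)`-invariant, for a finite subset `V` of `S`. -/
def IsFinsetInvariant (F : Set (Submodule R S)) (V : Finset S) (ε : ℝ) (W : Submodule R S) :
    Prop :=
  ∃ W' ∈ F, W ≤ W' ∧ (∀ w ∈ W, ∀ v ∈ V, w * v ∈ W') ∧
    (freeDim R W' : ℝ) ≤ (1 + ε) * freeDim R W

/-- `S` is a right amenable extension of `R` with the finite approximation system `F`. -/
structure IsRightAmenable (F : Set (Submodule R S)) : Prop extends IsFiniteApproxSystem F where
  exists_invariant : ∀ (V : Finset S) (ε : ℝ), 0 < ε → ∃ W ∈ hat F, IsFinsetInvariant F V ε W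

/-- `F` is normal, as witnessed by the multiplicative set `U` of non-zero-divisors of `S` that
normalize `R`. -/
structure IsNormalSystem (F : Set (Submodule R S)) (U : Submonoid S) : Prop where
  ne_zero : ∀ g ∈ U, g ≠ 0
  eq_zero_of_mul_left : ∀ g ∈ U, ∀ b : S, g * b = 0 → b = 0
  eq_zero_of_mul_right : ∀ g ∈ U, ∀ b : S, b * g = 0 → b = 0
  normalizes : ∀ g ∈ U, {x : S | ∃ a : R, x = g * (a : S)} = {x : S | ∃ a : R, x = (a : S) * g}
  exists_basis : ∀ W ∈ F, ∃ (n : ℕ) (b : Module.Basis (Fin n) R W), ∀ i, (b i : S) ∈ U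
  span_mem : ∀ g ∈ U, Submodule.span R {g} ∈ F
  div_mem : ∀ g ∈ U, ∀ W ∈ F, (∀ x ∈ W, ∃ s : S, x = s * g) →
    ∃ W' ∈ F, ∀ x : S, x ∈ W' ↔ x * g ∈ W

/-- `rk` is invariant under the automorphism `σ` of `R` given by `g a = σ(a) g`:
`rk(σ(A)) = rk(A)` for every matrix `A` over `R`. The second matrix below is `σ(A)`. -/
def SylvesterMatrixRank.IsInvariant (rk : SylvesterMatrixRank R) (g : S) : Prop :=
  ∀ (n m : ℕ) (A B : Matrix (Fin n) (Fin m) R),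
    (∀ i j, g * (A i j : S) = (B i j : S) * g) → rk.rk B = rk.rk A

/-- For `W ⊆ S` and a subset `M` of a left `S`-module, the set `WM` of finite sums of
elements `w x` with `w ∈ W` and `x ∈ M`. -/
def actSub {N : Type*} [AddCommGroup N] [Module S N] (W : Submodule R S) (M : Submodule R N) :
    Submodule R N :=
  Submodule.span R {z | ∃ w ∈ W, ∃ x ∈ M, z = w • x}

/-- `ψ(W)` converges to `L` when `W ∈ hat F` becomes more and more right invariant. -/
def ConvergesRightInvariant (F : Set (Submodule R S)) (ψ : Submodule R S → EReal) (L : EReal) :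
    Prop :=
  ∀ O ∈ 𝓝 L, ∃ V ∈ F, ∃ δ : ℝ, 0 < δ ∧ ∀ W ∈ hat F,
    (freeDim R ↥(W ⊔ actSub W V) : ℝ) ≤ (1 + δ) * freeDim R W → ψ W ∈ O

/-! ### The rank of a matrix over `S` relative to an element of the system -/

/-- `r = rk(B)` where, for some `W' ∈ hat F` with `W A i j ⊆ W'` for all `i`, `j`, some basis
`w` of `Wⁿ` and some basis `w'` of `W'ᵐ`, the matrix `B` over `R` expresses the row
vectors `w k A` through `w'`. -/
def IsRankValue (rk : SylvesterMatrixRank R) (F : Set (Submodule R S)) {n m : ℕ}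
    (A : Matrix (Fin n) (Fin m) S) (W : Submodule R S) (r : ℝ) : Prop :=
  ∃ W' ∈ hat F, (∀ i j, ∀ x ∈ W, x * A i j ∈ W') ∧
    ∃ (l p : ℕ) (w : Module.Basis (Fin l) R (Fin n → W)) (w' : Module.Basis (Fin p) R (Fin m → W'))
      (B : Matrix (Fin l) (Fin p) R),
      (∀ k j, ∑ i, (w k i : S) * A i j = ∑ q, (B k q : S) * (w' q j : S)) ∧ r = rk.rk B

/-- The map `Wⁿ → Sᵐ` sending a row vector `v` to `v A`. -/
def rowMap {n m : ℕ} (A : Matrix (Fin n) (Fin m) S) (W : Submodule R S) :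
    (Fin n → W) →ₗ[R] (Fin m → S) where
  toFun v := fun j => ∑ i, (v i : S) * A i j
  map_add' v v' := by
    ext j
    simp [add_mul, Finset.sum_add_distrib]
  map_smul' a v := by
    ext j
    simp [Finset.mul_sum, mul_assoc, Subring.smul_def]

/-- `rk(B) = dim(WⁿA|Sᵐ)`; in particular the number `r` does not depend on the choices. -/
theorem IsRankValue.ofReal_eq {rk : SylvesterMatrixRank R} {F : Set (Submodule R S)}
    (hF : IsFiniteApproxSystem F) {n m : ℕ} {A : Matrix (Fin n) (Fin m) S} {W : Submodule R S}
    {r : ℝ} (h : IsRankValue rk F A W r) :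
    ENNReal.ofReal r = rk.relDim (LinearMap.range (rowMap A W)) := by
  obtain ⟨W', ⟨hW', -⟩, -, l, p, w, w', B, hB, rfl⟩ := h
  have e1 : LinearMap.range (rowMap A W) = Submodule.span R (Set.range (rowMap A W ∘ w)) := by
    rw [LinearMap.range_eq_map, ← w.span_eq, Submodule.map_span, ← Set.range_comp]
  let inc : (Fin m → W') →ₗ[R] (Fin m → S) := W'.subtype.compLeft (Fin m)
  let t : Fin l → Fin m → W' := matTuple B w'
  have e2 : rowMap A W ∘ w = inc ∘ t := by
    ext k j
    refine (hB k j).trans ?_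
    have h1 := congrFun (congrFun (matTuple_map inc B w') k) j
    refine Eq.trans ?_ h1
    simp [matTuple_apply, Finset.sum_apply, inc, Subring.smul_def]
  have e3 : rk.tupleDim t = ENNReal.ofReal (rk.rk B) := by
    rw [← rk.rkF_fin, ← rk.tupleDim_free B]
    have a1 : (fun i => B i) = (w'.equivFun : _ →ₗ[R] (Fin p → R)) ∘ t := by
      rw [← matTuple_map]
      ext k q
      simp [matTuple_apply, Finset.sum_apply, Finsupp.single_apply]
    have a2 : t = (w'.equivFun.symm : (Fin p → R) →ₗ[R] _) ∘ (fun i => B i) := by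
      funext k
      exact (w'.equivFun.symm_apply_apply (t k)).symm.trans
        (congrArg w'.equivFun.symm (congrFun a1 k).symm)
    refine le_antisymm ?_ ?_
    · conv_lhs => rw [a2]
      exact rk.tupleDim_map_le _ _
    · conv_lhs => rw [a1]
      exact rk.tupleDim_map_le _ _
  rw [e1, rk.relDim_span, e2, ← e3]
  refine le_antisymm (rk.le_tupleDim fun k k' y C D hC hD => ?_) (rk.tupleDim_map_le _ _)
  obtain ⟨V, hV, hyV⟩ := hF.exists_ge
    (Submodule.span R (Set.range fun q : Fin k × Fin m => y q.1 q.2))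
    (Submodule.fg_span (Set.finite_range _))
  have hX := hF.sup_mem _ hW' _ hV
  obtain ⟨V', -, hbot, htop⟩ := hF.exists_compl _ hX _ hW' le_sup_left
  have hWX : W' ≤ W' ⊔ V := le_sup_left
  have hVX : V' ≤ W' ⊔ V := by
    rw [← htop]
    exact le_sup_right
  have hc : IsCompl (W'.submoduleOf (W' ⊔ V)) (V'.submoduleOf (W' ⊔ V)) := by
    constructor
    · rw [disjoint_iff, Submodule.submoduleOf, Submodule.submoduleOf, ← Submodule.comap_inf, hbot]
      exact LinearMap.ker_eq_bot.2 (Submodule.subtype_injective _)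
    · rw [codisjoint_iff]
      apply Submodule.map_injective_of_injective (Submodule.subtype_injective (W' ⊔ V))
      rw [Submodule.map_sup, Submodule.submoduleOf, Submodule.submoduleOf,
        Submodule.map_comap_subtype, Submodule.map_comap_subtype, inf_eq_right.2 hWX,
        inf_eq_right.2 hVX, htop]
      simp
  let π : ↥(W' ⊔ V) →ₗ[R] W' :=
    (Submodule.submoduleOfEquivOfLe hWX : _ →ₗ[R] W') ∘ₗ Submodule.projectionOnto _ _ hc
  have hπ : ∀ x : W', π (Submodule.inclusion hWX x) = x := by
    intro x
    have := Submodule.projectionOnto_apply_left hc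
      (⟨Submodule.inclusion hWX x, x.2⟩ : W'.submoduleOf (W' ⊔ V))
    simp only [π, LinearMap.comp_apply]
    erw [this]
    rfl
  let y' : Fin k → Fin m → ↥(W' ⊔ V) := fun j i =>
    ⟨y j i, (le_sup_right : V ≤ W' ⊔ V) (hyV (Submodule.subset_span ⟨(j, i), rfl⟩))⟩
  let incX : (Fin m → ↥(W' ⊔ V)) →ₗ[R] (Fin m → S) := (W' ⊔ V).subtype.compLeft (Fin m)
  have hinj : Function.Injective incX := fun a b hab => by
    ext i
    exact congrFun hab i
  have e4 : t = (π.compLeft (Fin m)) ∘ ((Submodule.inclusion hWX).compLeft (Fin m) ∘ t) := by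
    ext k i
    exact congrArg Subtype.val (hπ (t k i)).symm
  rw [e4]
  refine (rk.tupleDim_map_le _ _).trans (rk.tupleDim_le y' C D ?_ ?_)
  · ext1 i
    apply hinj
    exact (congrFun (matTuple_map incX C y') i).symm.trans (congrFun hC i)
  · ext1 i
    apply hinj
    exact (congrFun (matTuple_map incX D y') i).symm.trans ((congrFun hD i).trans (map_zero _).symm)

theorem IsRankValue.nonneg {rk : SylvesterMatrixRank R} {F : Set (Submodule R S)} {n m : ℕ}
    {A : Matrix (Fin n) (Fin m) S} {W : Submodule R S} {r : ℝ} (h : IsRankValue rk F A W r) :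
    0 ≤ r := by
  obtain ⟨W', -, -, l, p, w, w', B, -, rfl⟩ := h
  exact rk.nonneg B

theorem IsRankValue.unique {rk : SylvesterMatrixRank R} {F : Set (Submodule R S)}
    (hF : IsFiniteApproxSystem F) {n m : ℕ} {A : Matrix (Fin n) (Fin m) S} {W : Submodule R S}
    {r r' : ℝ} (h : IsRankValue rk F A W r) (h' : IsRankValue rk F A W r') : r = r' :=
  (ENNReal.ofReal_eq_ofReal_iff h.nonneg h'.nonneg).1
    ((h.ofReal_eq hF).trans (h'.ofReal_eq hF).symm)

theorem IsRankValue.exists (rk : SylvesterMatrixRank R) {F : Set (Submodule R S)}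
    (hF : IsFiniteApproxSystem F) {n m : ℕ} (A : Matrix (Fin n) (Fin m) S) {W : Submodule R S}
    (hW : W ∈ hat F) : ∃ r, IsRankValue rk F A W r := by
  obtain ⟨hfin, hfree⟩ := hF.finite_free W hW.1
  obtain ⟨V, hV, hle⟩ := hF.exists_ge
    (⨆ q : Fin n × Fin m, W.map ((LinearMap.toSpanSingleton S S (A q.1 q.2)).restrictScalars R))
    (Submodule.fg_iSup _ fun q => (Module.Finite.iff_fg.1 hfin).map _)
  have hmem : ∀ i j, ∀ x ∈ W, x * A i j ∈ W ⊔ V := fun i j x hx =>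
    (le_sup_right : V ≤ W ⊔ V) (hle ((le_iSup (fun q : Fin n × Fin m =>
      W.map ((LinearMap.toSpanSingleton S S (A q.1 q.2)).restrictScalars R)) (i, j))
      ⟨x, hx, rfl⟩))
  have hX := hF.sup_mem _ hW.1 _ hV
  obtain ⟨hfin', hfree'⟩ := hF.finite_free _ hX
  let b := (Module.Free.chooseBasis R (Fin n → W)).reindex (Fintype.equivFin _)
  let b' := (Module.Free.chooseBasis R (Fin m → ↥(W ⊔ V))).reindex (Fintype.equivFin _)
  let z : ∀ k, Fin m → ↥(W ⊔ V) := fun k j =>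
    ⟨∑ i, (b k i : S) * A i j, Submodule.sum_mem _ fun i _ => hmem i j _ (b k i).2⟩
  refine ⟨_, W ⊔ V, ⟨hX, fun h => hW.2 (eq_bot_iff.2 (h ▸ le_sup_left))⟩, hmem, _, _, b, b',
    Matrix.of fun k q => b'.repr (z k) q, fun k j => ?_, rfl⟩
  have h1 := congrArg (fun v : Fin m → ↥(W ⊔ V) => (v j : S)) (b'.sum_repr (z k))
  refine h1.symm.trans ?_
  simp [Finset.sum_apply, Subring.smul_def]

/-- `rk_W(A)`: the common value of all `r` with `IsRankValue rk F A W r`. -/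
noncomputable def rankOn (rk : SylvesterMatrixRank R) (F : Set (Submodule R S)) {n m : ℕ}
    (A : Matrix (Fin n) (Fin m) S) (W : Submodule R S) : ℝ :=
  sInf {r | IsRankValue rk F A W r}

theorem rankOn_eq {rk : SylvesterMatrixRank R} {F : Set (Submodule R S)}
    (hF : IsFiniteApproxSystem F) {n m : ℕ} {A : Matrix (Fin n) (Fin m) S} {W : Submodule R S}
    {r : ℝ} (h : IsRankValue rk F A W r) : rankOn rk F A W = r := by
  have : {r | IsRankValue rk F A W r} = {r} :=
    Set.eq_singleton_iff_unique_mem.2 ⟨h, fun _ h' => h'.unique hF h⟩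
  rw [rankOn, this, csInf_singleton]

/-- The ratio `rk_W(A) / dim(W)`. -/
noncomputable def rankRatio (rk : SylvesterMatrixRank R) (F : Set (Submodule R S)) {n m : ℕ}
    (A : Matrix (Fin n) (Fin m) S) (W : Submodule R S) : ℝ :=
  rankOn rk F A W / freeDim R W

/-- `dim_F(N₁|N) = L`, for left `S`-modules `N₁ ⊆ N` with `N₁` finitely generated: for
every finitely generated `R`-submodule `M` of `N₁` that generates `N₁` over `S`, the ratio
`dim(W M|N) / dim(W)` converges to `L` when `W` becomes more and more right invariant. -/
def HasApproxDim (rk : SylvesterMatrixRank R) (F : Set (Submodule R S)) {N : Type*}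
    [AddCommGroup N] [Module S N] (N₁ : Submodule S N) (L : EReal) : Prop :=
  N₁.FG ∧ ∀ M : Submodule R N, M.FG → Submodule.span S (M : Set N) = N₁ →
    ConvergesRightInvariant F
      (fun W => ((rk.relDim (actSub W M) / (freeDim R W : ℝ≥0∞) : ℝ≥0∞) : EReal)) L

/-- An ultrafilter on `hat F` is non-principal if it contains, for every finite `V ⊆ S`
and `ε > 0`, the set of all `(V, ε)`-invariant elements of `hat F`. -/
def IsNonPrincipal (F : Set (Submodule R S)) (ω : Ultrafilter (hat F)) : Prop :=
  ∀ (V : Finset S) (ε : ℝ), 0 < ε → {W : hat F | IsFinsetInvariant F V ε W} ∈ ω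

/-- The Ara–O'Meara–Perera ultralimit `rk_F(A)` of the ratios `rk_W(A) / dim(W)` along `ω`. -/
noncomputable def ultraRank (rk : SylvesterMatrixRank R) (F : Set (Submodule R S))
    (ω : Ultrafilter (hat F)) {n m : ℕ} (A : Matrix (Fin n) (Fin m) S) : ℝ :=
  Filter.limUnder (ω : Filter (hat F)) (fun W => rankRatio rk F A W)

end extension

/-! Let M be the R-span of the rows of A. Since the elements of F have bases that normalize R, WⁿA =
WM, so the ratio in question is φ(W)/dim(W) with φ(W) = dim(WM|Sᵐ). The statement then holds for
every finitely generated R-submodule M of a left S-module, and its proof uses only a few properties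
of φ (`IsInvariantSubadditive`): φ is monotone, linearly bounded, does not increase under W ↦ gW for
g in U, and is strongly subadditive, φ(W+V) + φ(W∩V) ≤ φ(W) + φ(V). The last property comes from
amalgamating two presentations along a common submodule (`tupleDim_sumElim_add_le`).

By definition no ratio is below the infimum. For the upper bound, fix V ≠ 0 and a slope l slightly
above φ(V)/dim(V). On F the rank is modular, so the defect d = φ - l dim is again strongly
subadditive, and d(V) < 0. Choose X that nearly minimizes d among the modules of rank at most
dim(V). When a translate gX is added to a sum T of earlier translates, the intersection gX ∩ T has
rank at most dim(X), hence has defect at least d(X) up to a small error a, and d(gX + T) ≤ d(T) + a.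
No disjointness of translates, and no quasi-tiling, is needed. Adding the translates by a basis of W
gives d(WX) ≤ a dim(W) (`actSub_sub_le`). If W is almost invariant under X, then W and WX nearly
agree in rank, and φ(W)/dim(W) is at most l plus a small error (`exists_le`).

If M and M' generate the same S-module, then M ⊆ VM' for some V in F, so WM ⊆ (WV)M', and almost
invariant W do not see the difference: the limit depends only on the S-module generated
(`infRatio_le_infRatio`). The ultralimits follow because a non-principal ultrafilter contains all
the sets of almost invariant modules. -/

namespace SylvesterMatrixRank

/-! ### Ranks of free modules and strong subadditivity -/

variable {R : Type u} [Ring R] (rk : SylvesterMatrixRank R)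

theorem rkF_one (n : ℕ) : rk.rkF (1 : Matrix (Fin n) (Fin n) R) = n := by
  induction n with
  | zero =>
    rw [show (1 : Matrix (Fin 0) (Fin 0) R) = 0 from Subsingleton.elim _ _, rk.rkF_zero]
    simp
  | succ n ih =>
    have h := rk.rkF_diag (1 : Matrix (Fin n) (Fin n) R) (1 : Matrix (Fin 1) (Fin 1) R)
    rw [Matrix.fromBlocks_one, ih, rk.rkF_one_unique (ι := Fin 1),
      ← rk.rkF_submatrix_equiv _ finSumFinEquiv.symm finSumFinEquiv.symm,
      Matrix.submatrix_one_equiv] at h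
    rw [h]
    push_cast
    ring

variable {M M' : Type*} [AddCommGroup M] [Module R M] [AddCommGroup M'] [Module R M']
  {ι ι₁ ι₂ : Type*} [Fintype ι] [Fintype ι₁] [Fintype ι₂]

theorem relDim_top_pi (n : ℕ) : rk.relDim (⊤ : Submodule R (Fin n → R)) = n := by
  have e : LinearMap.range (1 : Matrix (Fin n) (Fin n) R).vecMulLinear = ⊤ :=
    LinearMap.range_eq_top.2 fun x => ⟨x, by simp⟩
  rw [← e, rk.relDim_range, ← rk.rkF_fin, rk.rkF_one]
  simp

theorem relDim_top_of_equiv {n : ℕ} (e : M ≃ₗ[R] (Fin n → R)) :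
    rk.relDim (⊤ : Submodule R M) = n := by
  rw [← rk.relDim_equiv e, Submodule.map_top, LinearEquiv.range, relDim_top_pi]

/-- The rank function forces invariant basis number: any two admissible ranks both equal `rk.relDim
⊤`, so the set in the definition of `freeDim` is a singleton. -/
theorem freeDim_eq_of_equiv (rk : SylvesterMatrixRank R) {n : ℕ} (e : M ≃ₗ[R] (Fin n → R)) : freeDim R M = n := by
  have h : {k : ℕ | Nonempty (M ≃ₗ[R] (Fin k → R))} = {n} := by
    refine Set.eq_singleton_iff_unique_mem.2 ⟨⟨e⟩, ?_⟩
    rintro k ⟨e'⟩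
    exact_mod_cast (rk.relDim_top_of_equiv e').symm.trans (rk.relDim_top_of_equiv e)
  rw [freeDim, h, csInf_singleton]

theorem freeDim_eq_card (rk : SylvesterMatrixRank R) (b : Module.Basis ι R M) : freeDim R M = Fintype.card ι :=
  rk.freeDim_eq_of_equiv (b.reindex (Fintype.equivFin ι)).equivFun

theorem tupleDim_le_card (x : ι → M) : rk.tupleDim x ≤ Fintype.card ι := by
  let e := (Fintype.equivFin ι).symm
  have h : rk.tupleDim x ≤ rk.tupleDim (x ∘ e) :=
    rk.tupleDim_mono_span fun i => Submodule.subset_span ⟨e.symm i, by simp⟩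
  refine (h.trans (rk.tupleDim_le (x ∘ e) 1 (0 : Matrix (Fin 0) _ R) (matTuple_one _)
    (matTuple_zero_left _))).trans ?_
  have h1 := rk.rkF_fromRows_le (1 : Matrix (Fin (Fintype.card ι)) (Fin (Fintype.card ι)) R)
    (0 : Matrix (Fin 0) (Fin (Fintype.card ι)) R)
  rw [rk.rkF_zero, rk.rkF_one] at h1
  rw [rk.rkF_zero]
  refine (ENNReal.ofReal_le_ofReal (q := (Fintype.card ι : ℝ)) (by linarith)).trans ?_
  simp

/-- Strong subadditivity for tuples: every entry of `x₀` is a combination of `x₁` and also of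
`x₂`. -/
theorem tupleDim_sumElim_add_le (x₁ : ι₁ → M) (x₂ : ι₂ → M) (E₁ : Matrix ι ι₁ R)
    (E₂ : Matrix ι ι₂ R) (h : matTuple E₁ x₁ = matTuple E₂ x₂) :
    rk.tupleDim (Sum.elim x₁ x₂) + rk.tupleDim (matTuple E₂ x₂) ≤
      rk.tupleDim x₁ + rk.tupleDim x₂ := by
  classical
  refine rk.le_add_tupleDim fun m' k' y' C' B' hC' hB' => ?_
  rw [add_comm (rk.tupleDim x₁)]
  refine rk.le_add_tupleDim fun m k y C B hC hB => ?_
  rw [add_comm (ENNReal.ofReal _)]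
  -- The two presentations x₁ = Cy, By = 0 and x₂ = C'y', B'y' = 0 are amalgamated over the
  -- generators (y, y'): besides B and B', the relations contain E₁Cy - E₂C'y' = 0, which identifies
  -- the two expressions of the common tuple.
  let D : Matrix (Fin k ⊕ (ι ⊕ Fin k')) (Fin m ⊕ Fin m') R :=
    Matrix.fromBlocks B 0 (Matrix.fromRows (E₁ * C) 0) (Matrix.fromRows (-(E₂ * C')) B')
  have hD : matTuple D (Sum.elim y y') = 0 := by
    simp only [D]
    rw [← Matrix.fromRows_fromCols_eq_fromBlocks, matTuple_fromRows, matTuple_fromCols,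
      matTuple_fromCols, matTuple_fromRows, matTuple_fromRows, hB, hB', matTuple_zero_left,
      matTuple_zero_left, matTuple_mul, hC, h, ← hC', ← matTuple_mul]
    ext i
    rcases i with i | i | i <;> simp [matTuple_apply]
  have hCC : matTuple (Matrix.fromBlocks C 0 0 C') (Sum.elim y y') = Sum.elim x₁ x₂ := by
    rw [← Matrix.fromRows_fromCols_eq_fromBlocks, matTuple_fromRows, matTuple_fromCols,
      matTuple_fromCols, hC, hC', matTuple_zero_left, matTuple_zero_left, add_zero, zero_add]
  have t1 := rk.tupleDim_le _ _ D hCC hD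
  have t2 := rk.tupleDim_le y' (E₂ * C') B' (by rw [matTuple_mul, hC']) hB'
  refine (add_le_add t1 t2).trans ?_
  have n1 := rk.rkF_le_right (Matrix.fromBlocks C 0 0 C') D
  have n2 := rk.rkF_le_right (E₂ * C') B'
  have n3 := rk.rkF_le_right C B
  have n4 := rk.rkF_le_right C' B'
  rw [← ENNReal.ofReal_add (by linarith) (by linarith),
    ← ENNReal.ofReal_add (by linarith) (by linarith)]
  refine ENNReal.ofReal_le_ofReal ?_
  -- The rows of D are combinations of the rows of [C; B] and [C'; B'], so the extra relation does
  -- not increase the rank of the whole block.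
  have u1 : rk.rkF (Matrix.fromRows (Matrix.fromBlocks C 0 0 C') D) ≤
      rk.rkF (Matrix.fromRows C B) + rk.rkF (Matrix.fromRows C' B') := by
    rw [← rk.rkF_diag]
    have : Matrix.fromRows (Matrix.fromBlocks C 0 0 C') D =
        Matrix.fromRows
          (Matrix.fromBlocks (Matrix.fromCols (1 : Matrix ι₁ ι₁ R) (0 : Matrix ι₁ (Fin k) R)) 0 0
            (Matrix.fromCols (1 : Matrix ι₂ ι₂ R) (0 : Matrix ι₂ (Fin k') R)))
          (Matrix.fromBlocks
            (Matrix.fromCols (0 : Matrix (Fin k) ι₁ R) (1 : Matrix (Fin k) (Fin k) R)) 0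
            (Matrix.fromRows (Matrix.fromCols E₁ (0 : Matrix ι (Fin k) R)) 0)
            (Matrix.fromRows (Matrix.fromCols (-E₂) (0 : Matrix ι (Fin k') R))
              (Matrix.fromCols (0 : Matrix (Fin k') ι₂ R) (1 : Matrix (Fin k') (Fin k') R)))) *
        Matrix.fromBlocks (Matrix.fromRows C B) 0 0 (Matrix.fromRows C' B') := by
      simp only [D]
      rw [Matrix.fromRows_mul, Matrix.fromBlocks_multiply, Matrix.fromBlocks_multiply]
      simp [Matrix.fromCols_mul_fromRows, Matrix.fromRows_mul, Matrix.fromBlocks_mul_fromRows]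
    rw [this]
    exact rk.rkF_mul_le_right _ _
  -- Up to order, D is block triangular with diagonal blocks B and [-E₂C'; B']. The rank of the
  -- second, minus that of B', bounds the rank of the common tuple; this is where the gain comes
  -- from.
  have u2 : rk.rkF (Matrix.fromRows (E₂ * C') B') + rk.rkF B ≤ rk.rkF D := by
    have v := rk.rkF_upper (Matrix.fromRows (-(E₂ * C')) B') B
      (Matrix.fromRows (E₁ * C) (0 : Matrix (Fin k') (Fin m) R))
    have e1 : D.submatrix (Equiv.sumComm _ _) (Equiv.sumComm _ _) =
        Matrix.fromBlocks (Matrix.fromRows (-(E₂ * C')) B')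
          (Matrix.fromRows (E₁ * C) (0 : Matrix (Fin k') (Fin m) R)) 0 B := by
      ext i j
      rcases i with i | i <;> rcases j with j | j <;> rfl
    rw [← e1, rk.rkF_submatrix_equiv] at v
    have w : rk.rkF (Matrix.fromRows (E₂ * C') B') ≤
        rk.rkF (Matrix.fromRows (-(E₂ * C')) B') := by
      have : Matrix.fromRows (E₂ * C') B' =
          Matrix.fromBlocks (-1 : Matrix ι ι R) 0 0 (1 : Matrix (Fin k') (Fin k') R) *
            Matrix.fromRows (-(E₂ * C')) B' := by
        rw [Matrix.fromBlocks_mul_fromRows]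
        simp
      rw [this]
      exact rk.rkF_mul_le_right _ _
    linarith
  linarith

/-- Strong subadditivity of `dim(·|M)` on finitely generated submodules. -/
theorem relDim_sup_add_le {N₀ N₁ N₂ : Submodule R M} (h₀ : N₀.FG) (h₁ : N₁.FG) (h₂ : N₂.FG)
    (h₀₁ : N₀ ≤ N₁) (h₀₂ : N₀ ≤ N₂) :
    rk.relDim (N₁ ⊔ N₂) + rk.relDim N₀ ≤ rk.relDim N₁ + rk.relDim N₂ := by
  obtain ⟨_, x₀, rfl⟩ := Submodule.fg_iff_exists_fin_generating_family.1 h₀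
  obtain ⟨_, x₁, rfl⟩ := Submodule.fg_iff_exists_fin_generating_family.1 h₁
  obtain ⟨_, x₂, rfl⟩ := Submodule.fg_iff_exists_fin_generating_family.1 h₂
  obtain ⟨E₁, e₁⟩ := exists_matTuple_of_mem_span x₁ x₀
    fun i => h₀₁ (Submodule.subset_span ⟨i, rfl⟩)
  obtain ⟨E₂, rfl⟩ := exists_matTuple_of_mem_span x₂ x₀
    fun i => h₀₂ (Submodule.subset_span ⟨i, rfl⟩)
  rw [← Submodule.span_union, ← Set.Sum.elim_range, rk.relDim_span, rk.relDim_span, rk.relDim_span,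
    rk.relDim_span]
  exact rk.tupleDim_sumElim_add_le x₁ x₂ E₁ E₂ e₁

end SylvesterMatrixRank

/-! ### The products WM -/

section actSub

variable {S : Type u} [Ring S] {R : Subring S} {N : Type*} [AddCommGroup N] [Module S N]

theorem smul_mem_actSub {W : Submodule R S} {M : Submodule R N} {w : S} {x : N} (hw : w ∈ W)
    (hx : x ∈ M) : w • x ∈ actSub W M :=
  Submodule.subset_span ⟨w, hw, x, hx, rfl⟩

theorem actSub_le {W : Submodule R S} {M P : Submodule R N}
    (h : ∀ w ∈ W, ∀ x ∈ M, w • x ∈ P) : actSub W M ≤ P := by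
  refine Submodule.span_le.2 ?_
  rintro _ ⟨w, hw, x, hx, rfl⟩
  exact h w hw x hx

theorem actSub_mono {W W' : Submodule R S} {M M' : Submodule R N} (hW : W ≤ W') (hM : M ≤ M') :
    actSub W M ≤ actSub W' M' :=
  actSub_le fun _ hw _ hx => smul_mem_actSub (hW hw) (hM hx)

theorem actSub_sup_left (W W' : Submodule R S) (M : Submodule R N) :
    actSub (W ⊔ W') M = actSub W M ⊔ actSub W' M := by
  refine le_antisymm (actSub_le fun w hw x hx => ?_)
    (sup_le (actSub_mono le_sup_left le_rfl) (actSub_mono le_sup_right le_rfl))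
  obtain ⟨a, ha, b, hb, rfl⟩ := Submodule.mem_sup.1 hw
  rw [add_smul]
  exact Submodule.add_mem_sup (smul_mem_actSub ha hx) (smul_mem_actSub hb hx)

theorem actSub_assoc (W X : Submodule R S) (M : Submodule R N) :
    actSub (actSub W X) M = actSub W (actSub X M) := by
  apply le_antisymm
  · refine actSub_le fun z hz m hm => ?_
    refine Submodule.span_induction ?_ ?_ ?_ ?_ hz
    · rintro _ ⟨w, hw, x, hx, rfl⟩
      rw [smul_assoc]
      exact smul_mem_actSub hw (smul_mem_actSub hx hm)
    · rw [zero_smul]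
      exact zero_mem _
    · intro a b _ _ ha hb
      rw [add_smul]
      exact add_mem ha hb
    · intro r a _ ha
      rw [smul_assoc]
      exact Submodule.smul_mem _ r ha
  · refine actSub_le fun w hw z hz => ?_
    -- A scalar between w and z cannot be moved to the left of w, so the induction carries an
    -- arbitrary r, which the left R-module X absorbs.
    have h : ∀ r : R, w • r • z ∈ actSub (actSub W X) M := by
      refine Submodule.span_induction ?_ ?_ ?_ ?_ hz
      · rintro _ ⟨x, hx, m, hm, rfl⟩ r
        rw [← smul_assoc r, ← smul_assoc w]
        exact smul_mem_actSub (smul_mem_actSub hw (X.smul_mem r hx)) hm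
      · intro r
        rw [smul_zero, smul_zero]
        exact zero_mem _
      · intro a b _ _ ha hb r
        rw [smul_add, smul_add]
        exact add_mem (ha r) (hb r)
      · intro r' a _ ha r
        rw [← mul_smul]
        exact ha _
    simpa using h 1

end actSub

/-! ### Consequences of normality -/

namespace IsNormalSystem

variable {S : Type u} [Ring S] {R : Subring S} {N : Type*} [AddCommGroup N] [Module S N]
  {F : Set (Submodule R S)} {U : Submonoid S}

theorem exists_mul_left (hU : IsNormalSystem F U) {g : S} (hg : g ∈ U) (a : R) :
    ∃ b : R, g * a = b * g := by
  have h : g * a ∈ {x : S | ∃ a : R, x = g * (a : S)} := ⟨a, rfl⟩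
  rwa [hU.normalizes g hg] at h

theorem exists_mul_right (hU : IsNormalSystem F U) {g : S} (hg : g ∈ U) (a : R) :
    ∃ b : R, (a : S) * g = g * b := by
  have h : (a : S) * g ∈ {x : S | ∃ a : R, x = (a : S) * g} := ⟨a, rfl⟩
  rwa [← hU.normalizes g hg] at h

/-- Because gR = Rg, a scalar between w and x can be pulled out to the left, so the products of
generators suffice. In particular WM is finitely generated over R for W in F and M finitely
generated. -/
theorem actSub_span_span (hU : IsNormalSystem F U) {ι κ : Type*} {w : ι → S} (hw : ∀ i, w i ∈ U)
    (x : κ → N) : actSub (Submodule.span R (Set.range w)) (Submodule.span R (Set.range x)) =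
      Submodule.span R (Set.range fun p : ι × κ => w p.1 • x p.2) := by
  apply le_antisymm
  · refine actSub_le fun a ha z hz => ?_
    refine Submodule.span_induction ?_ ?_ ?_ ?_ ha
    · rintro _ ⟨i, rfl⟩
      refine Submodule.span_induction ?_ ?_ ?_ ?_ hz
      · rintro _ ⟨j, rfl⟩
        exact Submodule.subset_span ⟨(i, j), rfl⟩
      · rw [smul_zero]
        exact zero_mem _
      · intro b c _ _ hb hc
        rw [smul_add]
        exact add_mem hb hc
      · intro r b _ hb
        obtain ⟨r', hr'⟩ := hU.exists_mul_left (hw i) r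
        rw [Subring.smul_def, ← mul_smul, hr', mul_smul]
        exact Submodule.smul_mem _ r' hb
    · rw [zero_smul]
      exact zero_mem _
    · intro b c _ _ hb hc
      rw [add_smul]
      exact add_mem hb hc
    · intro r b _ hb
      rw [smul_assoc]
      exact Submodule.smul_mem _ r hb
  · rw [Submodule.span_le]
    rintro _ ⟨⟨i, j⟩, rfl⟩
    exact smul_mem_actSub (Submodule.subset_span ⟨i, rfl⟩) (Submodule.subset_span ⟨j, rfl⟩)

theorem actSub_singleton_span (hU : IsNormalSystem F U) {κ : Type*} {g : S} (hg : g ∈ U)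
    (x : κ → N) : actSub (Submodule.span R {g}) (Submodule.span R (Set.range x)) =
      Submodule.span R (Set.range fun j => g • x j) := by
  have h := hU.actSub_span_span (ι := Unit) (w := fun _ => g) (fun _ => hg) x
  rw [Set.range_const] at h
  rw [h]
  congr 1
  ext z
  simp

theorem actSub_singleton (hU : IsNormalSystem F U) {g : S} (hg : g ∈ U) (M : Submodule R N)
    {z : N} (hz : z ∈ actSub (Submodule.span R {g}) M) : ∃ x ∈ M, g • x = z := by
  have h := hU.actSub_singleton_span hg (fun x : M => (x : N))
  have hM : Submodule.span R (Set.range fun x : M => (x : N)) = M :=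
    (congrArg _ Subtype.range_coe).trans M.span_eq
  rw [hM] at h
  rw [h] at hz
  refine Submodule.span_induction ?_ ?_ ?_ ?_ hz
  · rintro _ ⟨x, rfl⟩
    exact ⟨x, x.2, rfl⟩
  · exact ⟨0, zero_mem _, smul_zero g⟩
  · rintro _ _ _ _ ⟨x, hx, rfl⟩ ⟨y, hy, rfl⟩
    exact ⟨x + y, add_mem hx hy, smul_add g x y⟩
  · rintro r _ _ ⟨x, hx, rfl⟩
    obtain ⟨r', hr'⟩ := hU.exists_mul_right hg r
    exact ⟨r' • x, M.smul_mem r' hx, by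
      rw [Subring.smul_def, Subring.smul_def, ← mul_smul, ← mul_smul, hr']⟩

theorem exists_family (hU : IsNormalSystem F U) {W : Submodule R S} (hW : W ∈ F) :
    ∃ (n : ℕ) (w : Fin n → S), (∀ i, w i ∈ U) ∧ LinearIndependent R w ∧
      Submodule.span R (Set.range w) = W := by
  obtain ⟨n, b, hb⟩ := hU.exists_basis W hW
  refine ⟨n, fun i => b i, hb, b.linearIndependent.map' W.subtype W.ker_subtype, ?_⟩
  have h := congrArg (Submodule.map W.subtype) b.span_eq
  rw [Submodule.map_span, ← Set.range_comp, Submodule.map_top, Submodule.range_subtype] at h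
  exact h

theorem linearIndependent_mul_left (hU : IsNormalSystem F U) {ι : Type*} [Fintype ι] {g : S}
    (hg : g ∈ U) {x : ι → S} (hx : LinearIndependent R x) :
    LinearIndependent R fun i => g * x i := by
  rw [Fintype.linearIndependent_iff] at hx ⊢
  intro r hr
  choose r' hr' using fun i => hU.exists_mul_right hg (r i)
  have h : g * ∑ i, r' i • x i = 0 := by
    rw [← hr, Finset.mul_sum]
    refine Finset.sum_congr rfl fun i _ => ?_
    rw [Subring.smul_def, Subring.smul_def, smul_eq_mul, smul_eq_mul, ← mul_assoc, ← mul_assoc,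
      hr']
  intro i
  -- Cancelling g on the left only kills the coefficients r' moved across g; since r g = g r',
  -- cancelling g on the right then kills r.
  have hi : (r i : S) * g = 0 := by
    rw [hr', hx r' (hU.eq_zero_of_mul_left g hg _ h) i]
    simp
  exact Subtype.ext (hU.eq_zero_of_mul_right g hg _ hi)

theorem linearIndependent_mul_right (hU : IsNormalSystem F U) {ι : Type*} [Fintype ι] {g : S}
    (hg : g ∈ U) {x : ι → S} (hx : LinearIndependent R x) :
    LinearIndependent R fun i => x i * g := by
  rw [Fintype.linearIndependent_iff] at hx ⊢
  intro r hr
  refine hx r (hU.eq_zero_of_mul_right g hg _ ?_)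
  rw [← hr, Finset.sum_mul]
  exact Finset.sum_congr rfl fun i _ => smul_mul_assoc _ _ _

end IsNormalSystem

/-! ### Ranks of the members of F -/

section freeDim

variable {S : Type u} [Ring S] {R : Subring S} {N : Type*} [AddCommGroup N] [Module S N]
  {F : Set (Submodule R S)} {U : Submonoid S}

theorem freeDim_span (rk : SylvesterMatrixRank R) {ι : Type*} [Fintype ι] {w : ι → S}
    (hw : LinearIndependent R w) :
    freeDim R (Submodule.span R (Set.range w)) = Fintype.card ι :=
  rk.freeDim_eq_card (Module.Basis.span hw)

theorem freeDim_bot (rk : SylvesterMatrixRank R) : freeDim R (⊥ : Submodule R S) = 0 :=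
  rk.freeDim_eq_card (Module.Basis.empty (ι := Fin 0) _)

theorem freeDim_pos (rk : SylvesterMatrixRank R) (hU : IsNormalSystem F U) {W : Submodule R S}
    (hW : W ∈ hat F) : 0 < freeDim R W := by
  obtain ⟨n, w, -, hli, rfl⟩ := hU.exists_family hW.1
  rw [freeDim_span rk hli, Fintype.card_fin, Nat.pos_iff_ne_zero]
  rintro rfl
  exact hW.2 (by rw [Set.range_eq_empty, Submodule.span_empty])

theorem freeDim_sup_of_disjoint (rk : SylvesterMatrixRank R) (hU : IsNormalSystem F U)
    {W V : Submodule R S} (hW : W ∈ F) (hV : V ∈ F) (h : W ⊓ V = ⊥) :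
    freeDim R ↥(W ⊔ V) = freeDim R W + freeDim R V := by
  obtain ⟨n, w, -, hw, rfl⟩ := hU.exists_family hW
  obtain ⟨m, v, -, hv, rfl⟩ := hU.exists_family hV
  rw [← Submodule.span_union, ← Set.Sum.elim_range, freeDim_span rk hw, freeDim_span rk hv,
    freeDim_span rk (hw.sum_type hv (disjoint_iff.2 h)), Fintype.card_sum]

/-- A complement in F of W ∩ V inside V is also a complement of W inside W + V; ranks add over both
decompositions. -/
theorem freeDim_sup_add_inf (rk : SylvesterMatrixRank R) (hF : IsFiniteApproxSystem F)
    (hU : IsNormalSystem F U) {W V : Submodule R S} (hW : W ∈ F) (hV : V ∈ F) :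
    freeDim R ↥(W ⊔ V) + freeDim R ↥(W ⊓ V) = freeDim R W + freeDim R V := by
  have hWV := hF.inf_mem _ hW _ hV
  obtain ⟨V', hV', hbot, htop⟩ := hF.exists_compl _ hV _ hWV inf_le_right
  have hV'V : V' ≤ V := htop ▸ le_sup_right
  have h1 : W ⊓ V' = ⊥ := by
    rw [← hbot, inf_assoc, inf_eq_right.2 hV'V]
  have h2 : W ⊔ V' = W ⊔ V := by
    nth_rw 1 [← sup_inf_self (a := W) (b := V)]
    rw [sup_assoc, htop]
  have h3 := freeDim_sup_of_disjoint rk hU hW hV' h1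
  have h4 := freeDim_sup_of_disjoint rk hU hWV hV' hbot
  rw [h2] at h3
  rw [htop] at h4
  omega

theorem freeDim_mono (rk : SylvesterMatrixRank R) (hF : IsFiniteApproxSystem F)
    (hU : IsNormalSystem F U) {W V : Submodule R S} (hW : W ∈ F) (hV : V ∈ F) (h : W ≤ V) :
    freeDim R W ≤ freeDim R V := by
  obtain ⟨V', hV', hbot, rfl⟩ := hF.exists_compl _ hV _ hW h
  rw [freeDim_sup_of_disjoint rk hU hW hV' hbot]
  exact Nat.le_add_right _ _

theorem IsFiniteApproxSystem.bot_mem (hF : IsFiniteApproxSystem F) : ⊥ ∈ F := by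
  obtain ⟨W, hW, -⟩ := hF.exists_ge ⊥ Submodule.fg_bot
  obtain ⟨V, hV, hbot, htop⟩ := hF.exists_compl W hW W hW le_rfl
  rw [inf_eq_right.2 (htop ▸ le_sup_right : V ≤ W)] at hbot
  exact hbot ▸ hV

theorem IsFiniteApproxSystem.span_mem (hF : IsFiniteApproxSystem F) (hU : IsNormalSystem F U)
    {ι : Type*} [Finite ι] {w : ι → S} (hw : ∀ i, w i ∈ U) :
    Submodule.span R (Set.range w) ∈ F := by
  have := Fintype.ofFinite ι
  rw [Submodule.span_range_eq_iSup, ← Finset.sup_univ_eq_iSup]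
  exact Finset.sup_induction (p := (· ∈ F)) hF.bot_mem hF.sup_mem
    fun i _ => hU.span_mem _ (hw i)

theorem IsFiniteApproxSystem.actSub_mem (hF : IsFiniteApproxSystem F) (hU : IsNormalSystem F U)
    {W V : Submodule R S} (hW : W ∈ F) (hV : V ∈ F) : actSub W V ∈ F := by
  obtain ⟨n, w, hwU, -, rfl⟩ := hU.exists_family hW
  obtain ⟨m, v, hvU, -, rfl⟩ := hU.exists_family hV
  rw [hU.actSub_span_span hwU]
  exact hF.span_mem hU fun p => U.mul_mem (hwU p.1) (hvU p.2)

theorem freeDim_actSub_singleton_left (rk : SylvesterMatrixRank R) (hU : IsNormalSystem F U)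
    {g : S} (hg : g ∈ U) {W : Submodule R S} (hW : W ∈ F) :
    freeDim R (actSub (Submodule.span R {g}) W) = freeDim R W := by
  obtain ⟨n, w, -, hw, rfl⟩ := hU.exists_family hW
  rw [hU.actSub_singleton_span hg, freeDim_span rk hw]
  exact freeDim_span rk (hU.linearIndependent_mul_left hg hw)

/-- A nonzero X contains some g in U, and WX contains Wg, which is free of the same rank as W since
g is not a zero-divisor. -/
theorem freeDim_le_actSub (rk : SylvesterMatrixRank R) (hF : IsFiniteApproxSystem F)
    (hU : IsNormalSystem F U) {W X : Submodule R S} (hW : W ∈ F) (hX : X ∈ hat F) :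
    freeDim R W ≤ freeDim R (actSub W X) := by
  obtain ⟨n, x, hxU, -, rfl⟩ := hU.exists_family hX.1
  have : Nonempty (Fin n) := by
    by_contra hn
    rw [not_nonempty_iff] at hn
    exact hX.2 (by rw [Set.range_eq_empty, Submodule.span_empty])
  obtain ⟨i⟩ := this
  have hmem := hF.actSub_mem hU hW hX.1
  obtain ⟨m, w, hwU, hw, rfl⟩ := hU.exists_family hW
  rw [freeDim_span rk hw, ← freeDim_span rk (hU.linearIndependent_mul_right (hxU i) hw)]
  refine freeDim_mono rk hF hU
    (hF.span_mem hU fun j => U.mul_mem (hwU j) (hxU i)) hmem (Submodule.span_le.2 ?_)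
  rintro _ ⟨j, rfl⟩
  exact smul_mem_actSub (Submodule.subset_span ⟨j, rfl⟩) (Submodule.subset_span ⟨i, rfl⟩)

end freeDim

/-! ### The ranks of the modules `W M` -/

section relDim

variable {S : Type u} [Ring S] {R : Subring S} {N : Type*} [AddCommGroup N] [Module S N]
  {F : Set (Submodule R S)} {U : Submonoid S} {rk : SylvesterMatrixRank R}

theorem SylvesterMatrixRank.IsInvariant.rkF_eq {g : S} (h : rk.IsInvariant g) {ι κ : Type*}
    [Fintype ι] [Fintype κ] {A B : Matrix ι κ R}
    (hAB : ∀ i j, g * (A i j : S) = (B i j : S) * g) : rk.rkF B = rk.rkF A :=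
  h _ _ _ _ fun _ _ => hAB _ _

theorem matTuple_map_smul {g : S} {σ : R → R} (hσ : ∀ a : R, g * a = σ a * g) {ι κ : Type*}
    [Fintype κ] (D : Matrix ι κ R) (y : κ → N) :
    matTuple (D.map σ) (fun j => g • y j) = fun i => g • matTuple D y i := by
  ext i
  rw [matTuple_apply, matTuple_apply, Finset.smul_sum]
  refine Finset.sum_congr rfl fun j _ => ?_
  rw [Subring.smul_def, Subring.smul_def, ← mul_smul, ← mul_smul, Matrix.map_apply, hσ]

/-- Multiplication by g is not R-linear but semilinear over σ. It turns a presentation (C, B) of x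
into a presentation (σ(C), σ(B)) of gx, and `rk` does not distinguish the two. -/
theorem SylvesterMatrixRank.IsInvariant.tupleDim_smul_le (hU : IsNormalSystem F U) {g : S}
    (hg : g ∈ U) (h : rk.IsInvariant g) {ι : Type*} [Fintype ι] (x : ι → N) :
    rk.tupleDim (fun i => g • x i) ≤ rk.tupleDim x := by
  refine rk.le_tupleDim fun m k y C B hC hB => ?_
  choose σ hσ using fun a => hU.exists_mul_left hg a
  refine (rk.tupleDim_le (fun j => g • y j) (C.map σ) (B.map σ) ?_ ?_).trans
    (le_of_eq ?_)
  · rw [matTuple_map_smul hσ, hC]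
  · rw [matTuple_map_smul hσ, hB]
    ext i
    exact smul_zero g
  · rw [h.rkF_eq (A := B) (B := B.map σ) fun i j => hσ _, h.rkF_eq (A := Matrix.fromRows C B)]
    rintro (i | i) j <;> exact hσ _

theorem SylvesterMatrixRank.IsInvariant.relDim_actSub_le (hU : IsNormalSystem F U) {g : S}
    (hg : g ∈ U) (h : rk.IsInvariant g) (M : Submodule R N) :
    rk.relDim (actSub (Submodule.span R {g}) M) ≤ rk.relDim M := by
  refine rk.relDim_le fun n z hz => ?_
  choose x hx hxz using fun i => hU.actSub_singleton hg M (hz i)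
  obtain rfl : (fun i => g • x i) = z := funext hxz
  exact (h.tupleDim_smul_le hU hg x).trans (rk.tupleDim_le_relDim x hx)

theorem IsNormalSystem.actSub_fg (hU : IsNormalSystem F U) {W : Submodule R S} (hW : W ∈ F)
    {M : Submodule R N} (hM : M.FG) : (actSub W M).FG := by
  obtain ⟨n, w, hwU, -, rfl⟩ := hU.exists_family hW
  obtain ⟨m, x, rfl⟩ := Submodule.fg_iff_exists_fin_generating_family.1 hM
  rw [hU.actSub_span_span hwU]
  exact Submodule.fg_span (Set.finite_range _)

/-- With C the size of a generating family of M, the module WM is generated by C · dim(W) products.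
-/
theorem exists_relDim_actSub_le (rk : SylvesterMatrixRank R) (hU : IsNormalSystem F U)
    {M : Submodule R N} (hM : M.FG) :
    ∃ C : ℕ, ∀ W ∈ F, rk.relDim (actSub W M) ≤ (C * freeDim R W : ℕ) := by
  obtain ⟨m, x, rfl⟩ := Submodule.fg_iff_exists_fin_generating_family.1 hM
  refine ⟨m, fun W hW => ?_⟩
  obtain ⟨n, w, hwU, hw, rfl⟩ := hU.exists_family hW
  rw [hU.actSub_span_span hwU, rk.relDim_span, freeDim_span rk hw]
  refine (rk.tupleDim_le_card _).trans (le_of_eq ?_)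
  rw [Fintype.card_prod, Fintype.card_fin, Fintype.card_fin, mul_comm]

/-- The module (W ∩ V)M may be smaller than WM ∩ VM, which need not be finitely generated; strong
subadditivity in the form `relDim_sup_add_le` only needs a finitely generated module contained in
both. -/
theorem relDim_actSub_sup_add_inf_le (rk : SylvesterMatrixRank R) (hF : IsFiniteApproxSystem F)
    (hU : IsNormalSystem F U) {M : Submodule R N} (hM : M.FG) {W V : Submodule R S} (hW : W ∈ F)
    (hV : V ∈ F) : rk.relDim (actSub (W ⊔ V) M) + rk.relDim (actSub (W ⊓ V) M) ≤
      rk.relDim (actSub W M) + rk.relDim (actSub V M) := by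
  rw [actSub_sup_left]
  exact rk.relDim_sup_add_le (hU.actSub_fg (hF.inf_mem _ hW _ hV) hM) (hU.actSub_fg hW hM)
    (hU.actSub_fg hV hM) (actSub_mono inf_le_left le_rfl) (actSub_mono inf_le_right le_rfl)

end relDim

/-! ### Limits along right invariant modules -/

section limits

variable {S : Type u} [Ring S] {R : Subring S} {F : Set (Submodule R S)} {U : Submonoid S}

/-- The properties of `W ↦ dim(W M|N)` that force `φ(W) / dim(W)` to converge to its infimum. -/
structure IsInvariantSubadditive (F : Set (Submodule R S)) (U : Submonoid S)
    (φ : Submodule R S → ℝ) (C : ℝ) : Prop where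
  nonneg : ∀ W, 0 ≤ φ W
  bot : φ ⊥ = 0
  mono : ∀ W ∈ F, ∀ V ∈ F, W ≤ V → φ W ≤ φ V
  sup_add_inf_le : ∀ W ∈ F, ∀ V ∈ F, φ (W ⊔ V) + φ (W ⊓ V) ≤ φ W + φ V
  actSub_le : ∀ g ∈ U, ∀ W ∈ F, φ (actSub (Submodule.span R {g}) W) ≤ φ W
  le_mul : ∀ W ∈ F, φ W ≤ C * freeDim R W

variable {φ : Submodule R S → ℝ} {C : ℝ}

/-- A complement of W in V contributes at most C times its rank. Together with monotonicity this
makes φ insensitive to small changes of rank. -/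
theorem IsInvariantSubadditive.le_add (hφ : IsInvariantSubadditive F U φ C)
    (rk : SylvesterMatrixRank R) (hF : IsFiniteApproxSystem F) (hU : IsNormalSystem F U)
    {W V : Submodule R S} (hW : W ∈ F) (hV : V ∈ F) (h : W ≤ V) :
    φ V ≤ φ W + C * (freeDim R V - freeDim R W) := by
  obtain ⟨Z, hZ, hbot, rfl⟩ := hF.exists_compl _ hV _ hW h
  have h1 := hφ.sup_add_inf_le W hW Z hZ
  rw [hbot, hφ.bot] at h1
  have h2 := hφ.le_mul Z hZ
  rw [freeDim_sup_of_disjoint rk hU hW hZ hbot]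
  push_cast
  linarith

/-- If the defect `φ - l dim` of `X` is at most `a` more than that of every module of at
most the same rank, then the defect of `W X` is at most `a dim(W)`. -/
theorem IsInvariantSubadditive.actSub_sub_le (hφ : IsInvariantSubadditive F U φ C)
    (rk : SylvesterMatrixRank R) (hF : IsFiniteApproxSystem F) (hU : IsNormalSystem F U)
    {l a : ℝ} {X : Submodule R S} (hX : X ∈ F)
    (h : ∀ Y ∈ F, freeDim R Y ≤ freeDim R X →
      φ X - l * freeDim R X ≤ φ Y - l * freeDim R Y + a)
    {W : Submodule R S} (hW : W ∈ F) :
    φ (actSub W X) - l * freeDim R (actSub W X) ≤ a * freeDim R W := by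
  obtain ⟨n, w, hwU, hw, rfl⟩ := hU.exists_family hW
  have key : ∀ s : Finset (Fin n), (⨆ i ∈ s, actSub (Submodule.span R {w i}) X) ∈ F ∧
      φ (⨆ i ∈ s, actSub (Submodule.span R {w i}) X) -
        l * freeDim R ↥(⨆ i ∈ s, actSub (Submodule.span R {w i}) X) ≤ a * s.card := by
    intro s
    induction s using Finset.induction_on with
    | empty =>
      have : (⨆ i ∈ (∅ : Finset (Fin n)), actSub (Submodule.span R {w i}) X) = ⊥ := by simp
      rw [this, hφ.bot, freeDim_bot rk]
      exact ⟨hF.bot_mem, by simp⟩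
    | insert i s hi ih =>
      rw [Finset.iSup_insert, Finset.card_insert_of_notMem hi]
      have hg := hF.actSub_mem hU (hU.span_mem _ (hwU i)) hX
      refine ⟨hF.sup_mem _ hg _ ih.1, ?_⟩
      -- Put d = φ - l dim and let T be the sum of the earlier translates. As dim is modular, d(gX +
      -- T) ≤ d(gX) + d(T) - d(gX ∩ T). Here d(gX) ≤ d(X), and `h` applies to gX ∩ T, whose rank is
      -- at most dim(gX) = dim(X); so each translate costs at most a.
      have h1 := hφ.sup_add_inf_le _ hg _ ih.1
      have h2 := freeDim_sup_add_inf rk hF hU hg ih.1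
      have hinf := hF.inf_mem _ hg _ ih.1
      have h3 := freeDim_mono rk hF hU hinf hg inf_le_left
      have h4 := freeDim_actSub_singleton_left rk hU (hwU i) hX
      have h5 := h _ hinf (h3.trans_eq h4)
      have h6 := hφ.actSub_le _ (hwU i) X hX
      have h7 := ih.2
      rw [h4] at h2
      have h2' := congrArg (fun k : ℕ => l * (k : ℝ)) h2
      push_cast at h2' ⊢
      linarith
  have e : actSub (Submodule.span R (Set.range w)) X =
      ⨆ i ∈ (Finset.univ : Finset (Fin n)), actSub (Submodule.span R {w i}) X := by
    apply le_antisymm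
    · obtain ⟨m, x, -, -, rfl⟩ := hU.exists_family hX
      rw [hU.actSub_span_span hwU, Submodule.span_le]
      rintro _ ⟨⟨i, j⟩, rfl⟩
      exact (le_iSup₂_of_le (f := fun i (_ : i ∈ (Finset.univ : Finset (Fin n))) =>
        actSub (Submodule.span R {w i}) (Submodule.span R (Set.range x))) i (Finset.mem_univ i)
        le_rfl) (smul_mem_actSub (Submodule.mem_span_singleton_self _)
          (Submodule.subset_span ⟨j, rfl⟩))
    · refine iSup₂_le fun i _ => actSub_mono ?_ le_rfl
      exact Submodule.span_mono (Set.singleton_subset_iff.2 ⟨i, rfl⟩)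
  rw [e, freeDim_span rk hw]
  exact (key Finset.univ).2

/-- The core of the convergence: the ratio at a single V bounds, up to ε, the ratios at all
sufficiently invariant W. The witness X is not V itself but a near minimizer of the defect. -/
theorem IsInvariantSubadditive.exists_le (hφ : IsInvariantSubadditive F U φ C) (hC : 0 ≤ C)
    (rk : SylvesterMatrixRank R) (hF : IsFiniteApproxSystem F) (hU : IsNormalSystem F U)
    {V : Submodule R S} (hV : V ∈ hat F) {ε : ℝ} (hε : 0 < ε) :
    ∃ X ∈ F, ∃ δ : ℝ, 0 < δ ∧ ∀ W ∈ hat F,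
      (freeDim R ↥(W ⊔ actSub W X) : ℝ) ≤ (1 + δ) * freeDim R W →
        φ W ≤ (φ V / freeDim R V + ε) * freeDim R W := by
  have hp : (0 : ℝ) < freeDim R V := by exact_mod_cast freeDim_pos rk hU hV
  set p : ℝ := (freeDim R V : ℝ) with hpdef
  -- A slope above the ratio of V, so that the defect of V is strictly negative.
  set l : ℝ := φ V / p + ε / 2 with hl
  have hl0 : 0 < l := by
    have := div_nonneg (hφ.nonneg V) hp.le
    positivity
  let d : Submodule R S → ℝ := fun X => φ X - l * freeDim R X
  have hdV : d V < 0 := by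
    have : φ V / p * p = φ V := div_mul_cancel₀ _ hp.ne'
    simp only [d, hl]
    rw [← hpdef]
    nlinarith [mul_pos hε hp]
  -- The rank bound keeps the defects above -l dim(V). As φ takes real values, the infimum need not
  -- be attained.
  let D : Set ℝ := {a | ∃ X ∈ F, freeDim R X ≤ freeDim R V ∧ a = d X}
  have hVD : d V ∈ D := ⟨V, hV.1, le_rfl, rfl⟩
  have hbdd : BddBelow D := by
    refine ⟨-(l * p), ?_⟩
    rintro _ ⟨X, -, hX, rfl⟩
    have h1 := hφ.nonneg X
    have h2 : (freeDim R X : ℝ) ≤ p := Nat.cast_le.2 hX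
    have h3 := mul_le_mul_of_nonneg_left h2 hl0.le
    simp only [d]
    linarith
  have hm : sInf D ≤ d V := csInf_le hbdd hVD
  -- The tolerance ε/4 is the constant a of `actSub_sub_le`; the tolerance -inf D makes d(X)
  -- negative, whence X ≠ 0.
  obtain ⟨_, ⟨X, hX, hXV, rfl⟩, hXm⟩ := exists_lt_of_csInf_lt ⟨_, hVD⟩
    (show sInf D < sInf D + min (ε / 4) (-sInf D) from
      lt_add_of_pos_right _ (lt_min (by linarith) (by linarith)))
  have hX1 : d X < sInf D + ε / 4 := hXm.trans_le (by gcongr; exact min_le_left _ _)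
  have hX0 : d X < 0 := hXm.trans_le (by linarith [min_le_right (ε / 4) (-sInf D)])
  have hXb : X ≠ ⊥ := by
    rintro rfl
    simp only [d, hφ.bot, freeDim_bot rk] at hX0
    simp at hX0
  -- The invariance error δ enters as lδ, since dim(WX) may be (1 + δ) dim(W), and as Cδ, in passing
  -- from WX to W + WX. With (l + C)δ = ε/4 the total slope is l + ε/4 + ε/4 = φ(V)/dim(V) + ε.
  refine ⟨X, hX, ε / 4 / (l + C), by positivity, fun W hW hinv => ?_⟩
  have hWX := hF.actSub_mem hU hW.1 hX
  have h1 := hφ.actSub_sub_le rk hF hU (l := l) (a := ε / 4) hX (fun Y hY hYX => by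
    have : sInf D ≤ d Y := csInf_le hbdd ⟨Y, hY, hYX.trans hXV, rfl⟩
    simp only [d] at this hX1
    linarith) hW.1
  have hT := hF.sup_mem _ hW.1 _ hWX
  -- The chain is φ(W) ≤ φ(W + WX) ≤ φ(WX) + C(dim(W + WX) - dim(WX)); the bracket is at most δ
  -- dim(W) because dim(WX) ≥ dim(W).
  have h2 := hφ.mono _ hW.1 _ hT le_sup_left
  have h3 := hφ.le_add rk hF hU hWX hT le_sup_right
  have h4 : (freeDim R W : ℝ) ≤ freeDim R (actSub W X) := by
    exact_mod_cast freeDim_le_actSub rk hF hU hW.1 ⟨hX, hXb⟩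
  have h5 : (freeDim R (actSub W X) : ℝ) ≤ freeDim R ↥(W ⊔ actSub W X) := by
    exact_mod_cast freeDim_mono rk hF hU hWX hT le_sup_right
  have h6 := mul_le_mul_of_nonneg_left (h5.trans hinv) hl0.le
  have h7 := mul_le_mul_of_nonneg_left (sub_le_sub hinv h4) hC
  have h8 : (l + C) * (ε / 4 / (l + C)) = ε / 4 := by
    field_simp
  have h9 : φ V / p = l - ε / 2 := by rw [hl]; ring
  rw [h9]
  have h10 := congrArg (· * (freeDim R W : ℝ)) h8
  nlinarith

theorem convergesRightInvariant_of_forall {ψ : Submodule R S → ℝ} {L : ℝ}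
    (h : ∀ ε : ℝ, 0 < ε → ∃ V ∈ F, ∃ δ : ℝ, 0 < δ ∧ ∀ W ∈ hat F,
      (freeDim R ↥(W ⊔ actSub W V) : ℝ) ≤ (1 + δ) * freeDim R W → |ψ W - L| < ε) :
    ConvergesRightInvariant F (fun W => ((ψ W : ℝ) : EReal)) (L : EReal) := by
  intro O hO
  have hO' : (fun x : ℝ => (x : EReal)) ⁻¹' O ∈ 𝓝 L :=
    (continuous_coe_real_ereal.tendsto L) hO
  obtain ⟨ε, hε, hball⟩ := Metric.mem_nhds_iff.1 hO'
  obtain ⟨V, hV, δ, hδ, hW⟩ := h ε hε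
  exact ⟨V, hV, δ, hδ, fun W hWF hinv => hball (by
    rw [Metric.mem_ball, Real.dist_eq]
    exact hW W hWF hinv)⟩

theorem IsRightAmenable.nonempty_hat (hF : IsRightAmenable F) : (hat F).Nonempty := by
  obtain ⟨W, hW, -⟩ := hF.exists_invariant ∅ 1 one_pos
  exact ⟨W, hW⟩

/-- `(V, ε)`-invariance for a finite set of generators of an element of the system. -/
theorem exists_finset_invariant (rk : SylvesterMatrixRank R) (hF : IsFiniteApproxSystem F)
    (hU : IsNormalSystem F U) {V : Submodule R S} (hV : V ∈ F) :
    ∃ v : Finset S, ∀ ε : ℝ, ∀ W ∈ F, IsFinsetInvariant F v ε W →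
      (freeDim R ↥(W ⊔ actSub W V) : ℝ) ≤ (1 + ε) * freeDim R W := by
  classical
  obtain ⟨m, v, hvU, -, rfl⟩ := hU.exists_family hV
  refine ⟨Finset.univ.image v, ?_⟩
  rintro ε W hW ⟨W', hW', hle, hmem, hdim⟩
  refine le_trans ?_ hdim
  have hT := hF.sup_mem _ hW _ (hF.actSub_mem hU hW hV)
  refine Nat.cast_le.2 (freeDim_mono rk hF hU hT hW' (sup_le hle ?_))
  obtain ⟨n, w, hwU, -, rfl⟩ := hU.exists_family hW
  rw [hU.actSub_span_span hwU, Submodule.span_le]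
  rintro _ ⟨⟨i, j⟩, rfl⟩
  exact hmem _ (Submodule.subset_span ⟨i, rfl⟩) _ (Finset.mem_image_of_mem v (Finset.mem_univ j))

/-- Right invariance is hereditary in the finitely generated module on the right. -/
theorem freeDim_sup_actSub_le (rk : SylvesterMatrixRank R) (hF : IsFiniteApproxSystem F)
    (hU : IsNormalSystem F U) {W V V' : Submodule R S} (hW : W ∈ F) (hV : V ∈ F) (hV' : V' ∈ F)
    (h : V ≤ V') {δ δ' : ℝ} (hδ : δ' ≤ δ)
    (hinv : (freeDim R ↥(W ⊔ actSub W V') : ℝ) ≤ (1 + δ') * freeDim R W) :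
    (freeDim R ↥(W ⊔ actSub W V) : ℝ) ≤ (1 + δ) * freeDim R W := by
  refine (Nat.cast_le.2 (freeDim_mono rk hF hU (hF.sup_mem _ hW _ (hF.actSub_mem hU hW hV))
    (hF.sup_mem _ hW _ (hF.actSub_mem hU hW hV'))
    (sup_le_sup_left (actSub_mono le_rfl h) _))).trans (hinv.trans ?_)
  gcongr

/-- The infimum of `φ(V) / dim(V)` over the nonzero `V` in `F`. -/
noncomputable def infRatio (F : Set (Submodule R S)) (φ : Submodule R S → ℝ) : ℝ :=
  sInf ((fun W => φ W / freeDim R W) '' hat F)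

theorem IsInvariantSubadditive.isGLB (hφ : IsInvariantSubadditive F U φ C)
    (hne : (hat F).Nonempty) :
    IsGLB ((fun W => φ W / freeDim R W) '' hat F) (infRatio F φ) := by
  refine isGLB_csInf (hne.image _) ⟨0, ?_⟩
  rintro _ ⟨W, -, rfl⟩
  exact div_nonneg (hφ.nonneg W) (Nat.cast_nonneg _)

/-- Only the upper bound needs an argument: it is `exists_le` for a V whose ratio is within ε/2 of
the infimum. -/
theorem IsInvariantSubadditive.exists_abs_sub_lt (hφ : IsInvariantSubadditive F U φ C)
    (hC : 0 ≤ C) (rk : SylvesterMatrixRank R) (hF : IsFiniteApproxSystem F)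
    (hU : IsNormalSystem F U) (hne : (hat F).Nonempty) {ε : ℝ} (hε : 0 < ε) :
    ∃ V ∈ F, ∃ δ : ℝ, 0 < δ ∧ ∀ W ∈ hat F,
      (freeDim R ↥(W ⊔ actSub W V) : ℝ) ≤ (1 + δ) * freeDim R W →
        |φ W / freeDim R W - infRatio F φ| < ε := by
  have hglb := hφ.isGLB hne
  obtain ⟨_, ⟨V, hV, rfl⟩, -, hVε⟩ :=
    hglb.exists_between (show infRatio F φ < infRatio F φ + ε / 2 by linarith)
  obtain ⟨X, hX, δ, hδ, h⟩ := hφ.exists_le hC rk hF hU hV (half_pos hε)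
  refine ⟨X, hX, δ, hδ, fun W hW hinv => ?_⟩
  have h1 := h W hW hinv
  rw [← div_le_iff₀ (by exact_mod_cast freeDim_pos rk hU hW)] at h1
  have h2 := hglb.1 ⟨W, hW, rfl⟩
  simp only at h2 hVε
  rw [abs_lt]
  constructor <;> linarith

/-- On a W that is almost invariant under V, φ' changes little from W to W + WV, and its ratio is
near its infimum. Right amenability supplies such a W. -/
theorem infRatio_le_infRatio {φ' : Submodule R S → ℝ} {C' : ℝ}
    (hφ : IsInvariantSubadditive F U φ C) (hφ' : IsInvariantSubadditive F U φ' C') (hC' : 0 ≤ C')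
    (rk : SylvesterMatrixRank R) (hF : IsRightAmenable F) (hU : IsNormalSystem F U)
    {V : Submodule R S} (hV : V ∈ F) (h : ∀ W ∈ F, φ W ≤ φ' (W ⊔ actSub W V)) :
    infRatio F φ ≤ infRatio F φ' := by
  have hF' := hF.toIsFiniteApproxSystem
  refine le_of_forall_pos_le_add fun ε hε => ?_
  obtain ⟨X, hX, δ, hδ, hXδ⟩ :=
    hφ'.exists_abs_sub_lt hC' rk hF' hU hF.nonempty_hat (half_pos hε)
  have hXV := hF.sup_mem _ hX _ hV
  obtain ⟨v, hv⟩ := exists_finset_invariant rk hF' hU hXV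
  -- The bound δ brings φ'(W)/dim(W) within ε/2 of its infimum; the other bound limits the growth of
  -- φ' from W to W + WV to (ε/2) dim(W), where C' + 1 avoids division by zero.
  obtain ⟨W, hW, hinv⟩ := hF.exists_invariant v (min δ (ε / 2 / (C' + 1)))
    (lt_min hδ (by positivity))
  have hinv' := hv _ W hW.1 hinv
  have h1 := hXδ W hW
    (freeDim_sup_actSub_le rk hF' hU hW.1 hX hXV le_sup_left (min_le_left _ _) hinv')
  have h2 := freeDim_sup_actSub_le rk hF' hU hW.1 hV hXV le_sup_right (min_le_right _ _) hinv'
  have h3 := hφ'.le_add rk hF' hU hW.1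
    (hF.sup_mem _ hW.1 _ (hF'.actSub_mem hU hW.1 hV)) le_sup_left
  have hq : (0 : ℝ) < freeDim R W := by exact_mod_cast freeDim_pos rk hU hW
  have h4 := (hφ.isGLB hF.nonempty_hat).1 ⟨W, hW, rfl⟩
  refine h4.trans ?_
  simp only
  have h5 := (abs_lt.1 h1).2
  rw [sub_lt_iff_lt_add, div_lt_iff₀ hq] at h5
  rw [div_le_iff₀ hq]
  have h6 : C' * (freeDim R ↥(W ⊔ actSub W V) - freeDim R W : ℝ) ≤ ε / 2 * freeDim R W := by
    have h7 : (freeDim R ↥(W ⊔ actSub W V) - freeDim R W : ℝ) ≤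
        ε / 2 / (C' + 1) * freeDim R W := by linarith
    have h8 : C' * (ε / 2 / (C' + 1)) ≤ ε / 2 := by
      rw [mul_div_assoc', div_le_iff₀ (by positivity)]
      nlinarith
    calc _ ≤ C' * (ε / 2 / (C' + 1) * freeDim R W) := mul_le_mul_of_nonneg_left h7 hC'
      _ = C' * (ε / 2 / (C' + 1)) * freeDim R W := by ring
      _ ≤ _ := mul_le_mul_of_nonneg_right h8 hq.le
  have h9 := h W hW.1
  nlinarith

/-- Convergence in the sense of right invariance implies convergence along non-principal
ultrafilters. -/
theorem tendsto_ultrafilter (rk : SylvesterMatrixRank R) (hF : IsFiniteApproxSystem F)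
    (hU : IsNormalSystem F U) {ψ : Submodule R S → ℝ} {L : ℝ}
    (h : ∀ ε : ℝ, 0 < ε → ∃ V ∈ F, ∃ δ : ℝ, 0 < δ ∧ ∀ W ∈ hat F,
      (freeDim R ↥(W ⊔ actSub W V) : ℝ) ≤ (1 + δ) * freeDim R W → |ψ W - L| < ε)
    {ω : Ultrafilter (hat F)} (hω : IsNonPrincipal F ω) :
    Filter.Tendsto (fun W : hat F => ψ W) (ω : Filter (hat F)) (𝓝 L) := by
  rw [Metric.tendsto_nhds]
  intro ε hε
  obtain ⟨V, hV, δ, hδ, hW⟩ := h ε hε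
  obtain ⟨v, hv⟩ := exists_finset_invariant rk hF hU hV
  filter_upwards [hω v δ hδ] with W hinv
  rw [Real.dist_eq]
  exact hW W W.2 (hv δ W W.2.1 hinv)

end limits

/-! ### The rank of `W M` relative to the rank of `W` -/

section moduleRank

variable {S : Type u} [Ring S] {R : Subring S} {N : Type*} [AddCommGroup N] [Module S N]
  {F : Set (Submodule R S)} {U : Submonoid S} {rk : SylvesterMatrixRank R}

/-- `dim(W M|N)` as a real number. -/
noncomputable def moduleRank (rk : SylvesterMatrixRank R) (M : Submodule R N)
    (W : Submodule R S) : ℝ :=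
  (rk.relDim (actSub W M)).toReal

theorem relDim_actSub_ne_top (rk : SylvesterMatrixRank R) (hU : IsNormalSystem F U)
    {M : Submodule R N} (hM : M.FG) {W : Submodule R S} (hW : W ∈ F) :
    rk.relDim (actSub W M) ≠ ⊤ := by
  obtain ⟨C, hC⟩ := exists_relDim_actSub_le rk hU hM
  exact ((hC W hW).trans_lt (ENNReal.natCast_lt_top _)).ne

theorem exists_isInvariantSubadditive (hF : IsFiniteApproxSystem F) (hU : IsNormalSystem F U)
    (hrk : ∀ g ∈ U, rk.IsInvariant g) {M : Submodule R N} (hM : M.FG) :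
    ∃ C : ℝ, 0 ≤ C ∧ IsInvariantSubadditive F U (moduleRank rk M) C := by
  obtain ⟨C, hC⟩ := exists_relDim_actSub_le rk hU hM
  have hfin : ∀ W ∈ F, rk.relDim (actSub W M) ≠ ⊤ :=
    fun W hW => relDim_actSub_ne_top rk hU hM hW
  refine ⟨C, Nat.cast_nonneg C, ⟨fun W => ENNReal.toReal_nonneg, ?_, ?_, ?_, ?_, ?_⟩⟩
  · have h := hC ⊥ hF.bot_mem
    rw [freeDim_bot rk, mul_zero, Nat.cast_zero, nonpos_iff_eq_zero] at h
    rw [moduleRank, h, ENNReal.toReal_zero]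
  · exact fun W _ V hV h =>
      ENNReal.toReal_mono (hfin V hV) (rk.relDim_mono (actSub_mono h le_rfl))
  · intro W hW V hV
    have h := relDim_actSub_sup_add_inf_le rk hF hU hM hW hV
    have h' := ENNReal.toReal_mono (ENNReal.add_ne_top.2 ⟨hfin W hW, hfin V hV⟩) h
    rwa [ENNReal.toReal_add (hfin _ (hF.sup_mem _ hW _ hV)) (hfin _ (hF.inf_mem _ hW _ hV)),
      ENNReal.toReal_add (hfin W hW) (hfin V hV)] at h'
  · intro g hg W hW
    refine ENNReal.toReal_mono (hfin W hW) ?_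
    -- (gW)M = g(WM), so the invariance of `rk` applies to the single module WM.
    rw [actSub_assoc]
    exact (hrk g hg).relDim_actSub_le hU hg _
  · intro W hW
    have h := ENNReal.toReal_mono (ENNReal.natCast_ne_top _) (hC W hW)
    rw [ENNReal.toReal_natCast] at h
    exact_mod_cast h

theorem exists_mem_actSub (hF : IsFiniteApproxSystem F) (hU : IsNormalSystem F U)
    (M : Submodule R N) {z : N} (hz : z ∈ Submodule.span S (M : Set N)) :
    ∃ V ∈ F, z ∈ actSub V M := by
  refine Submodule.span_induction ?_ ?_ ?_ ?_ hz
  · intro x hx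
    obtain ⟨V, hV, h1⟩ := hF.exists_ge (Submodule.span R {1}) (Submodule.fg_span_singleton 1)
    refine ⟨V, hV, ?_⟩
    have := smul_mem_actSub (h1 (Submodule.mem_span_singleton_self 1)) hx
    rwa [one_smul] at this
  · exact ⟨⊥, hF.bot_mem, zero_mem _⟩
  · rintro x y - - ⟨V, hV, hx⟩ ⟨V', hV', hy⟩
    refine ⟨V ⊔ V', hF.sup_mem _ hV _ hV', ?_⟩
    rw [actSub_sup_left]
    exact Submodule.add_mem_sup hx hy
  · rintro s x - ⟨V, hV, hx⟩
    obtain ⟨V', hV', hs⟩ := hF.exists_ge (Submodule.span R {s}) (Submodule.fg_span_singleton s)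
    refine ⟨actSub V' V, hF.actSub_mem hU hV' hV, ?_⟩
    rw [actSub_assoc]
    exact smul_mem_actSub (hs (Submodule.mem_span_singleton_self s)) hx

/-- Each generator of M involves finitely many coefficients from S, and F is directed, so one V
serves all of them. -/
theorem exists_le_actSub (hF : IsFiniteApproxSystem F) (hU : IsNormalSystem F U)
    {M M' : Submodule R N} (hM : M.FG) (h : (M : Set N) ⊆ Submodule.span S (M' : Set N)) :
    ∃ V ∈ F, M ≤ actSub V M' := by
  obtain ⟨n, x, rfl⟩ := Submodule.fg_iff_exists_fin_generating_family.1 hM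
  choose V hV hx using fun i =>
    exists_mem_actSub hF hU M' (h (Submodule.subset_span (Set.mem_range_self i)))
  obtain ⟨V', hV', hle⟩ := hF.exists_ge (⨆ i, V i) (Submodule.fg_iSup _ fun i =>
    Module.Finite.iff_fg.1 (hF.finite_free _ (hV i)).1)
  refine ⟨V', hV', Submodule.span_le.2 ?_⟩
  rintro _ ⟨i, rfl⟩
  exact actSub_mono ((le_iSup V i).trans hle) le_rfl (hx i)

theorem infRatio_moduleRank_le (hF : IsRightAmenable F) (hU : IsNormalSystem F U)
    (hrk : ∀ g ∈ U, rk.IsInvariant g) {M M' : Submodule R N} (hM : M.FG) (hM' : M'.FG)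
    (h : (M : Set N) ⊆ Submodule.span S (M' : Set N)) :
    infRatio F (moduleRank rk M) ≤ infRatio F (moduleRank rk M') := by
  have hF' := hF.toIsFiniteApproxSystem
  obtain ⟨C, -, hφ⟩ := exists_isInvariantSubadditive hF' hU hrk hM
  obtain ⟨C', hC', hφ'⟩ := exists_isInvariantSubadditive hF' hU hrk hM'
  obtain ⟨V, hV, hle⟩ := exists_le_actSub hF' hU hM h
  refine infRatio_le_infRatio hφ hφ' hC' rk hF hU hV fun W hW => ?_
  have hWV := hF'.actSub_mem hU hW hV
  refine ENNReal.toReal_mono (relDim_actSub_ne_top rk hU hM' (hF.sup_mem _ hW _ hWV))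
    (rk.relDim_mono ((actSub_mono le_rfl hle).trans ?_))
  rw [← actSub_assoc]
  exact actSub_mono le_sup_right le_rfl

/-- Two finitely generated R-modules with the same S-span lie in the S-spans of each other, so
`infRatio_moduleRank_le` in both directions gives them the same limit. -/
theorem hasApproxDim_of_fg (hF : IsRightAmenable F) (hU : IsNormalSystem F U)
    (hrk : ∀ g ∈ U, rk.IsInvariant g) {M : Submodule R N} (hM : M.FG) :
    HasApproxDim rk F (Submodule.span S (M : Set N)) (infRatio F (moduleRank rk M) : EReal) := by
  have hF' := hF.toIsFiniteApproxSystem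
  constructor
  · obtain ⟨s, rfl⟩ := hM
    exact ⟨s, (Submodule.span_span_of_tower R S _).symm⟩
  intro M' hM' hspan
  have hL : infRatio F (moduleRank rk M) = infRatio F (moduleRank rk M') :=
    le_antisymm (infRatio_moduleRank_le hF hU hrk hM hM' (hspan ▸ Submodule.subset_span))
      (infRatio_moduleRank_le hF hU hrk hM' hM (hspan ▸ Submodule.subset_span))
  obtain ⟨C, hC, hφ⟩ := exists_isInvariantSubadditive hF' hU hrk hM'
  have hconv := convergesRightInvariant_of_forall fun ε hε =>
    hφ.exists_abs_sub_lt hC rk hF' hU hF.nonempty_hat hε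
  rw [hL]
  intro O hO
  obtain ⟨V, hV, δ, hδ, hW⟩ := hconv O hO
  refine ⟨V, hV, δ, hδ, fun W hWF hinv => ?_⟩
  have h := hW W hWF hinv
  have hne : rk.relDim (actSub W M') / (freeDim R W : ℝ≥0∞) ≠ ⊤ :=
    ENNReal.div_ne_top (relDim_actSub_ne_top rk hU hM' hWF.1)
      (Nat.cast_ne_zero.2 (freeDim_pos rk hU hWF).ne')
  beta_reduce
  rw [← EReal.coe_ennreal_toReal hne, ENNReal.toReal_div, ENNReal.toReal_natCast]
  exact h

/-- Normality is what makes the range as large as WM: an element w(rA_i), with r in R, is the image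
of a row vector over W because w r = r'w for w in U. -/
theorem range_rowMap (hU : IsNormalSystem F U) {n m : ℕ} (A : Matrix (Fin n) (Fin m) S)
    {W : Submodule R S} (hW : W ∈ F) :
    LinearMap.range (rowMap A W) = actSub W (Submodule.span R (Set.range A.row)) := by
  apply le_antisymm
  · rintro _ ⟨v, rfl⟩
    have : rowMap A W v = ∑ i, (v i : S) • A.row i := by
      ext j
      simp [rowMap]
    rw [this]
    exact sum_mem fun i _ => smul_mem_actSub (v i).2 (Submodule.subset_span ⟨i, rfl⟩)
  · obtain ⟨k, w, hwU, -, rfl⟩ := hU.exists_family hW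
    rw [hU.actSub_span_span hwU, Submodule.span_le]
    rintro _ ⟨⟨i, j⟩, rfl⟩
    refine ⟨Pi.single j ⟨w i, Submodule.subset_span ⟨i, rfl⟩⟩, ?_⟩
    ext c
    simp only [rowMap, LinearMap.coe_mk, AddHom.coe_mk, Pi.smul_apply, smul_eq_mul, Matrix.row]
    rw [Finset.sum_eq_single j]
    · rw [Pi.single_eq_same]
    · intro b _ hb
      rw [Pi.single_eq_of_ne hb]
      simp
    · simp

theorem rankOn_eq_moduleRank (hF : IsFiniteApproxSystem F) (hU : IsNormalSystem F U) {n m : ℕ}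
    (A : Matrix (Fin n) (Fin m) S) {W : Submodule R S} (hW : W ∈ hat F) :
    rankOn rk F A W = moduleRank rk (Submodule.span R (Set.range A.row)) W := by
  obtain ⟨r, hr⟩ := IsRankValue.exists rk hF A hW
  rw [rankOn_eq hF hr, moduleRank, ← range_rowMap hU A hW.1, ← hr.ofReal_eq hF,
    ENNReal.toReal_ofReal hr.nonneg]

theorem rankRatio_eq (hF : IsFiniteApproxSystem F) (hU : IsNormalSystem F U) {n m : ℕ}
    (A : Matrix (Fin n) (Fin m) S) {W : Submodule R S} (hW : W ∈ hat F) :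
    rankRatio rk F A W =
      moduleRank rk (Submodule.span R (Set.range A.row)) W / freeDim R W := by
  rw [rankRatio, rankOn_eq_moduleRank hF hU A hW]

end moduleRank

/-! ### The limit formula for matrices -/

theorem theorem1p1 {S : Type u} [Ring S] (R : Subring S) (rk : SylvesterMatrixRank R)
    (F : Set (Submodule R S)) (U : Submonoid S)
    (hF : IsRightAmenable F) (hU : IsNormalSystem F U)
    (hrk : ∀ g ∈ U, rk.IsInvariant g)
    {n m : ℕ} (A : Matrix (Fin n) (Fin m) S) :
    ∃ L : ℝ,
      IsGLB (rankRatio rk F A '' hat F) L ∧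
      ConvergesRightInvariant F (fun W => ((rankRatio rk F A W : ℝ) : EReal)) (L : EReal) ∧
      HasApproxDim rk F (LinearMap.range A.vecMulLinear) (L : EReal) ∧
      ∀ ω : Ultrafilter (hat F), IsNonPrincipal F ω →
        Filter.Tendsto (fun W : hat F => rankRatio rk F A W) (ω : Filter (hat F)) (𝓝 L) ∧
        ultraRank rk F ω A = L := by
  have hF' := hF.toIsFiniteApproxSystem
  have hM : (Submodule.span R (Set.range A.row)).FG := Submodule.fg_span (Set.finite_range _)
  obtain ⟨C, hC, hφ⟩ := exists_isInvariantSubadditive hF' hU hrk hM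
  have hlim : ∀ ε : ℝ, 0 < ε → ∃ V ∈ F, ∃ δ : ℝ, 0 < δ ∧ ∀ W ∈ hat F,
      (freeDim R ↥(W ⊔ actSub W V) : ℝ) ≤ (1 + δ) * freeDim R W →
        |rankRatio rk F A W -
          infRatio F (moduleRank rk (Submodule.span R (Set.range A.row)))| < ε := by
    intro ε hε
    obtain ⟨V, hV, δ, hδ, h⟩ := hφ.exists_abs_sub_lt hC rk hF' hU hF.nonempty_hat hε
    refine ⟨V, hV, δ, hδ, fun W hW hinv => ?_⟩
    rw [rankRatio_eq hF' hU A hW]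
    exact h W hW hinv
  refine ⟨infRatio F (moduleRank rk (Submodule.span R (Set.range A.row))), ?_,
    convergesRightInvariant_of_forall hlim, ?_, fun ω hω => ?_⟩
  · rw [Set.image_congr fun W hW => rankRatio_eq hF' hU A hW]
    exact hφ.isGLB hF.nonempty_hat
  · have h := hasApproxDim_of_fg hF hU hrk hM
    -- The S-span of the R-span of the rows is the row space SⁿA.
    rwa [Submodule.span_span_of_tower, ← range_vecMulLinear] at h
  · have h := tendsto_ultrafilter rk hF' hU hlim hω
    exact ⟨h, h.limUnder_eq⟩
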